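/- Let $U,V,V_1\in L^\infty(\mathbb R)$ be real-valued with compact support and, for $\lambda>0$, let $V_\lambda\in L^\infty(\mathbb R)$ be real-valued, with support contained in a compact interval that does not depend on $\lambda$ for $\lambda$ small, such that $\|V_\lambda-V-\lambda V_1\|_{L_2(\mathbb R)}=o(\lambda)$ as $\lambda\to0^+$. Let $H_\lambda=-\frac{d^2}{dx^2}+U+\lambda V_\lambda$ in $L_2(\mathbb R)$ with domain $W_2^2(\mathbb R)$. Assume that $-\frac{d^2}{dx^2}+U$ has a zero-energy resonance with normalized half-bound state $u$, i.e. $u$ is a bounded solution of $-u''+Uu=0$ on $\mathbb R$ with $\lim_{x\to-\infty}u(x)=1$, and put $\theta=\lim_{x\to+\infty}u(x)$. Let $v_*$ be the solution of $-v''+Uv=-Vu$ that vanishes to the left of the supports of $U$ and $V$. Suppose that $$\int_{\mathbb R}Vu^2\,dx=0\qquad\text{and}\qquad\int_{\mathbb R}(Vv_*+V_1u)\,u\,dx<0 .$$ Then $\lambda=0$ is a coupling constant threshold for $H_\lambda$: for all small positive $\lambda$ there exists a negative eigenvalue $e_\lambda$ of $H_\lambda$ such that $e_\lambda\to0$ as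 $\lambda\to0^+$. Moreover, every such threshold eigenvalue $e_\lambda$ satisfies $$e_\lambda=-\frac{\lambda^4}{(\theta^2+1)^2}\left(\int_{\mathbb R}Vv_*u\,dx+\int_{\mathbb R}V_1u^2\,dx\right)^2+o(\lambda^4)\qquad\text{as }\lambda\to0^+ .$$ -/

import Mathlib

open MeasureTheory Filter Topology Asymptotics

/-- `f` is (a representative of) a real function in `L^∞(ℝ)` with compact (essential) support. -/
def IsBoundedCompactlySupported (f : ℝ → ℝ) : Prop :=
  MemLp f ⊤ volume ∧ ∃ R : ℝ, ∀ᵐ x : ℝ, R < |x| → f x = 0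

/-- `y` is a solution on the whole line of `-y'' + U y = f`: `y` is `C^1` with locally absolutely
continuous derivative, and the equation holds almost everywhere. -/
def IsSolution (U f y : ℝ → ℝ) : Prop :=
  Differentiable ℝ y ∧
  (∀ a b : ℝ, AbsolutelyContinuousOnInterval (deriv y) a b) ∧
  ∀ᵐ x : ℝ, -deriv (deriv y) x + U x * y x = f x

/-- `u` is a half-bound state of `-d²/dx² + U`: a nontrivial solution of `-u'' + U u = 0` that is
bounded on the whole line (so that the operator has a zero-energy resonance). -/
def IsHalfBoundState (U u : ℝ → ℝ) : Prop :=
  IsSolution U 0 u ∧ u ≠ 0 ∧ ∃ C : ℝ, ∀ x : ℝ, |u x| ≤ C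

/-- A half-bound state normalized by `u(x) → 1` as `x → -∞`, with `u(x) → θ` as `x → +∞`. -/
def IsNormalizedHalfBoundState (U u : ℝ → ℝ) (θ : ℝ) : Prop :=
  IsHalfBoundState U u ∧ Tendsto u atBot (𝓝 1) ∧ Tendsto u atTop (𝓝 θ)

/-- `v` is the solution of `-v'' + U v = -V u` that vanishes near `-∞`. When `U` and `V` have
compact support this is the same as vanishing to the left of the supports of `U` and `V`, since
there the equation reads `v'' = 0`. -/
def IsVStar (U V u v : ℝ → ℝ) : Prop :=
  IsSolution U (fun x => -(V x * u x)) v ∧ ∀ᶠ x : ℝ in atBot, v x = 0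

/-- Membership in the Sobolev space `W_2^2(ℝ)` (complex valued), for the `C^1` representative. -/
def MemW22 (ψ : ℝ → ℂ) : Prop :=
  Differentiable ℝ ψ ∧
  (∀ a b : ℝ, AbsolutelyContinuousOnInterval (deriv ψ) a b) ∧
  MemLp ψ 2 volume ∧ MemLp (deriv ψ) 2 volume ∧ MemLp (deriv (deriv ψ)) 2 volume

/-- `e` is an eigenvalue of the operator `-d²/dx² + q` in `L_2(ℝ)` with domain `W_2^2(ℝ)`. -/
def IsSchrodingerEigenvalue (q : ℝ → ℝ) (e : ℝ) : Prop :=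
  ∃ ψ : ℝ → ℂ, MemW22 ψ ∧ ψ ≠ 0 ∧
    ∀ᵐ x : ℝ, -deriv (deriv ψ) x + (q x : ℂ) * ψ x = (e : ℂ) * ψ x

/-- For the operators `H_lam = -d²/dx² + q lam`, `lam > 0`: for all small positive `lam` the number
`e lam` is a negative eigenvalue of `H_lam`, and `e lam → 0` as `lam → 0`. -/
def IsThresholdEigenvalue (q : ℝ → ℝ → ℝ) (e : ℝ → ℝ) : Prop :=
  (∀ᶠ lam : ℝ in 𝓝[>] 0, e lam < 0 ∧ IsSchrodingerEigenvalue (q lam) (e lam)) ∧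
  Tendsto e (𝓝[>] 0) (𝓝 0)

/-- `lam = 0` is a coupling constant threshold for the operators `-d²/dx² + q lam`. -/
def HasCouplingConstantThreshold (q : ℝ → ℝ → ℝ) : Prop :=
  ∃ e : ℝ → ℝ, IsThresholdEigenvalue q e

/-!
Write `e = -k²` with `k > 0`, and let all the potentials vanish outside `[a, b]`. A square
integrable solution of `-y'' + (U + lam Vl + k²) y = 0` is a multiple of `exp (k x)` to the left of
`a` and of `exp (-k x)` to the right of `b`. So `-k²` is an eigenvalue exactly when the solution
`F` on `[a, b]` with `F(a) = 1`, `F'(a) = k` (`jost`) satisfies `F'(b) + k F(b) = 0`; the left side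
is `mismatch` (`mismatch_eq_zero_of_eigenvalue`, `eigenvalue_of_mismatch_eq_zero`).

The half-bound state has `u(a) = 1`, `u(b) = θ`, `u'(a) = u'(b) = 0`. The Wronskian identity for `F`
and `u` (`jostDeriv_mul_sub`) reads `θ F'(b) = k + ∫ (lam Vl + k²) F u`. Inserting
`F = u + O(lam + k)` and `F = u + lam v + O(lam² + k)` (`solution_sub_isBigO`,
`solution_sub_sub_isBigO`) and using `∫ V u² = 0`, one gets
`θ · mismatch = k (1 + θ²) + lam² I + o(k + lam²)` with `I = ∫ V v u + ∫ V₁ u² < 0`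
(`matching_isLittleO`, `mismatch_isLittleO`), as `(lam, k)` tends to `(0, 0)`. Since `θ ≠ 0`, the
intermediate value theorem between two parabolas `k = t lam²` gives a root (`exists_root`), and any
root that tends to `0` is `-lam² I / (1 + θ²) + o(lam²)` (`root_isLittleO`). Squaring it gives the
expansion of the eigenvalue.

The coefficients are only measurable and bounded, so the equation on `[a, b]` is treated in integral
form: the operators `prim a b q : y ↦ ∫ₐˣ q y` act on bounded continuous functions, depend
linearly on `q`, and are bounded by the `L¹` norm of `q` on `[a, b]`. Solutions are obtained by inverting
`1 - volterra a b q`, the Volterra operator being quasinilpotent (`isUnit_one_sub_volterra`).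
-/

open scoped BoundedContinuousFunction

/-! ### Primitives and Volterra operators on bounded continuous functions -/

/-- The nearest point of `[a, b]` to `x`. -/
def clamp (a b x : ℝ) : ℝ := max a (min b x)

lemma continuous_clamp (a b : ℝ) : Continuous (clamp a b) := by
  unfold clamp; fun_prop

lemma le_clamp (a b x : ℝ) : a ≤ clamp a b x := le_max_left _ _

lemma clamp_le {a b : ℝ} (hab : a ≤ b) (x : ℝ) : clamp a b x ≤ b :=
  max_le hab (min_le_left _ _)

lemma clamp_of_mem {a b x : ℝ} (hx : x ∈ Set.Icc a b) : clamp a b x = x := by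
  rw [clamp, min_eq_right hx.2, max_eq_right hx.1]

lemma clamp_right {a b : ℝ} (hab : a ≤ b) : clamp a b b = b :=
  clamp_of_mem ⟨hab, le_rfl⟩

lemma Ioc_clamp_subset (a b x : ℝ) : Set.Ioc a (clamp a b x) ⊆ Set.Ioc a b := by
  intro t ht
  refine ⟨ht.1, ?_⟩
  rcases le_max_iff.1 ht.2 with h | h
  · exact absurd h (not_le.2 ht.1)
  · exact h.trans (min_le_left _ _)

lemma MeasureTheory.LocallyIntegrable.on_interval {q : ℝ → ℝ} (hq : LocallyIntegrable q volume)
    (s t : ℝ) : IntervalIntegrable q volume s t :=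
  intervalIntegrable_iff.2 <| (hq.integrableOn_isCompact isCompact_uIcc).mono_set
    Set.uIoc_subset_uIcc

lemma MeasureTheory.LocallyIntegrable.mul_bcf {q : ℝ → ℝ} (hq : LocallyIntegrable q volume)
    (y : ℝ →ᵇ ℝ) (s t : ℝ) : IntervalIntegrable (fun x => q x * y x) volume s t :=
  (hq.on_interval s t).mul_continuousOn y.continuous.continuousOn

lemma norm_integral_clamp_le {q : ℝ → ℝ} (hq : LocallyIntegrable q volume) (a b : ℝ)
    (y : ℝ →ᵇ ℝ) (x : ℝ) :
    ‖∫ t in a..clamp a b x, q t * y t‖ ≤ (∫ t in Set.Ioc a b, |q t|) * ‖y‖ := by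
  have hi : IntegrableOn q (Set.Ioc a b) := (hq.on_interval a b).1
  rw [← integral_mul_const, intervalIntegral.integral_of_le (le_clamp _ _ _)]
  refine (norm_integral_le_integral_norm _).trans ?_
  have h1 : IntegrableOn (fun t => |q t| * ‖y‖) (Set.Ioc a b) := hi.abs.mul_const _
  refine (integral_mono_of_nonneg (Eventually.of_forall fun t => norm_nonneg _)
    (h1.mono_set (Ioc_clamp_subset a b x)) (Eventually.of_forall fun t => ?_)).trans
    (setIntegral_mono_set h1 (Eventually.of_forall fun t => by positivity)
      (Ioc_clamp_subset a b x).eventuallyLE)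
  simp only [norm_mul, Real.norm_eq_abs]
  gcongr
  exact y.norm_coe_le_norm t

open Classical in
/-- The operator `y ↦ ∫ₐˣ q y` on bounded continuous functions, where the upper end `x` is clamped
to `[a, b]`. It is `0` by convention when `q` is not locally integrable. -/
noncomputable def prim (a b : ℝ) (q : ℝ → ℝ) : (ℝ →ᵇ ℝ) →L[ℝ] (ℝ →ᵇ ℝ) :=
  if hq : LocallyIntegrable q volume then
    LinearMap.mkContinuous
      { toFun := fun y => BoundedContinuousFunction.ofNormedAddCommGroup
          (fun x => ∫ t in a..clamp a b x, q t * y t)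
          ((intervalIntegral.continuous_primitive (hq.mul_bcf y) a).comp (continuous_clamp a b))
          ((∫ t in Set.Ioc a b, |q t|) * ‖y‖) (norm_integral_clamp_le hq a b y)
        map_add' := fun y z => by
          ext x
          simp only [BoundedContinuousFunction.coe_ofNormedAddCommGroup,
            BoundedContinuousFunction.coe_add, Pi.add_apply, mul_add]
          exact intervalIntegral.integral_add (hq.mul_bcf y _ _) (hq.mul_bcf z _ _)
        map_smul' := fun c y => by
          ext x
          simp only [BoundedContinuousFunction.coe_ofNormedAddCommGroup,
            BoundedContinuousFunction.coe_smul, smul_eq_mul, RingHom.id_apply,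
            ← intervalIntegral.integral_const_mul]
          congr 1
          ext t
          ring }
      (∫ t in Set.Ioc a b, |q t|)
      (fun y => by
        refine (BoundedContinuousFunction.norm_le (by positivity)).2 fun x => ?_
        exact norm_integral_clamp_le hq a b y x)
  else 0

section
variable {a b : ℝ} {p q : ℝ → ℝ}

lemma prim_apply (hq : LocallyIntegrable q volume) (y : ℝ →ᵇ ℝ) (x : ℝ) :
    prim a b q y x = ∫ t in a..clamp a b x, q t * y t := by
  rw [prim, dif_pos hq]; rfl

/-- Only the `L¹` norm of `q` on `[a, b]` matters: this is what makes `L²` convergence of the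
potentials sufficient. -/
lemma norm_prim_le (a b : ℝ) (q : ℝ → ℝ) : ‖prim a b q‖ ≤ ∫ t in Set.Ioc a b, |q t| := by
  have h0 : 0 ≤ ∫ t in Set.Ioc a b, |q t| := by positivity
  unfold prim
  split_ifs with h
  · exact LinearMap.mkContinuous_norm_le _ h0 _
  · exact (norm_zero (E := (ℝ →ᵇ ℝ) →L[ℝ] (ℝ →ᵇ ℝ))).trans_le h0

lemma prim_add (hp : LocallyIntegrable p volume) (hq : LocallyIntegrable q volume) :
    prim a b (fun x => p x + q x) = prim a b p + prim a b q := by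
  ext y x
  rw [prim_apply (show LocallyIntegrable (fun x => p x + q x) volume from hp.add hq)]
  simp only [add_apply, BoundedContinuousFunction.coe_add, Pi.add_apply,
    prim_apply hp, prim_apply hq, add_mul]
  exact intervalIntegral.integral_add (hp.mul_bcf y _ _) (hq.mul_bcf y _ _)

lemma prim_const_mul (hq : LocallyIntegrable q volume) (c : ℝ) :
    prim a b (fun x => c * q x) = c • prim a b q := by
  ext y x
  rw [prim_apply (show LocallyIntegrable (fun x => c * q x) volume from hq.smul c)]
  simp only [smul_apply, BoundedContinuousFunction.coe_smul, smul_eq_mul,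
    prim_apply hq, mul_assoc]
  exact intervalIntegral.integral_const_mul _ _

lemma locallyIntegrable_one : LocallyIntegrable (fun _ : ℝ => (1 : ℝ)) volume :=
  continuous_const.locallyIntegrable

lemma prim_const (c : ℝ) : prim a b (fun _ => c) = c • prim a b (fun _ => 1) := by
  simpa using prim_const_mul (a := a) (b := b) locallyIntegrable_one c

/-- Integration by parts for functions of the form `const + prim q g`. -/
lemma mul_eq_add_prim (hp : LocallyIntegrable p volume) (hq : LocallyIntegrable q volume)
    {y z g h : ℝ →ᵇ ℝ} {α β : ℝ} (hab : a ≤ b)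
    (hy : y = α • 1 + prim a b p g) (hz : z = β • 1 + prim a b q h) :
    y * z = (α * β) • 1 + prim a b p (g * z) + prim a b q (y * h) := by
  ext x
  set c := clamp a b x with hc
  have hac : a ≤ c := le_clamp _ _ _
  have key : ∀ {r : ℝ → ℝ} (hr : LocallyIntegrable r volume) (w : ℝ →ᵇ ℝ),
      AbsolutelyContinuousOnInterval (fun x => ∫ t in a..x, r t * w t) a c ∧
      ∀ᵐ x, x ∈ Set.uIcc a c → HasDerivAt (fun x => ∫ t in a..x, r t * w t) (r x * w x) x := by
    intro r hr w
    exact ⟨(hr.mul_bcf w a c).absolutelyContinuousOnInterval_intervalIntegral (by simp),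
      (hr.mul_bcf w a c).ae_hasDerivAt_integral.mono fun x hx h => hx h a (by simp)⟩
  obtain ⟨A1, D1⟩ := key hp g
  obtain ⟨A2, D2⟩ := key hq h
  have hval : ∀ {r : ℝ → ℝ} {w f : ℝ →ᵇ ℝ} {γ : ℝ}, LocallyIntegrable r volume →
      f = γ • 1 + prim a b r w → ∀ t ∈ Set.Icc a b, f t = γ + ∫ s in a..t, r s * w s := by
    intro r w f γ hr hf t ht
    rw [hf]
    simp [prim_apply hr, clamp_of_mem ht]
  have hcb : Set.uIcc a c ⊆ Set.Icc a b := by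
    rw [Set.uIcc_of_le hac]; exact Set.Icc_subset_Icc_right (clamp_le hab x)
  have hx : ∀ {r : ℝ → ℝ} {w f : ℝ →ᵇ ℝ} {γ : ℝ}, LocallyIntegrable r volume →
      f = γ • 1 + prim a b r w → f x = γ + ∫ s in a..c, r s * w s := by
    intro r w f γ hr hf
    rw [hf]; simp [prim_apply hr, hc]
  have C : ∀ γ : ℝ, AbsolutelyContinuousOnInterval (fun _ : ℝ => γ) a c := fun γ =>
    (LipschitzWith.const γ).lipschitzOnWith.absolutelyContinuousOnInterval
  have A := ((C α).fun_add A1).fun_mul ((C β).fun_add A2)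
  have H := A.integral_deriv_eq_sub
  simp only [intervalIntegral.integral_same, add_zero] at H
  simp only [BoundedContinuousFunction.coe_mul, BoundedContinuousFunction.coe_add, Pi.mul_apply,
    Pi.add_apply, BoundedContinuousFunction.coe_smul, smul_eq_mul, prim_apply hp, prim_apply hq,
    BoundedContinuousFunction.coe_one, Pi.one_apply, mul_one, ← hc]
  rw [hx hp hy, hx hq hz, add_assoc, ← intervalIntegral.integral_add, ← sub_eq_iff_eq_add', ← H]
  · refine intervalIntegral.integral_congr_ae ?_
    filter_upwards [D1, D2] with t h1 h2 ht
    have ht' := Set.uIoc_subset_uIcc ht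
    have hd := ((h1 ht').const_add α).fun_mul ((h2 ht').const_add β)
    rw [hd.deriv, hval hp hy t (hcb ht'), hval hq hz t (hcb ht')]
    ring
  · simpa using hp.mul_bcf (g * z) a c
  · simpa using hq.mul_bcf (y * h) a c

/-- Each integration against a bounded `q` gains one power of `x - a` and the factor `1 / (n + 1)`. -/
lemma abs_prim_apply_le (hq : LocallyIntegrable q volume) {M : ℝ} (hM : ∀ᵐ x, |q x| ≤ M)
    {y : ℝ →ᵇ ℝ} {c : ℝ} {n : ℕ} (hy : ∀ x, |y x| ≤ c * (clamp a b x - a) ^ n)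
    (x : ℝ) : |prim a b q y x| ≤ M * c / (n + 1) * (clamp a b x - a) ^ (n + 1) := by
  have hM0 : 0 ≤ M := by
    obtain ⟨x, hx⟩ := hM.exists
    exact (abs_nonneg _).trans hx
  rw [prim_apply hq]
  have hac := le_clamp a b x
  have : ∫ t in a..clamp a b x, M * (c * (t - a) ^ n) =
      M * c / (n + 1) * (clamp a b x - a) ^ (n + 1) := by
    simp only [intervalIntegral.integral_const_mul]
    rw [intervalIntegral.integral_comp_sub_right (fun t => t ^ n), integral_pow]
    simp
    field_simp
  rw [← this, ← Real.norm_eq_abs]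
  refine intervalIntegral.norm_integral_le_of_norm_le hac ?_
    (Continuous.intervalIntegrable (by fun_prop) _ _)
  filter_upwards [hM] with t ht hta
  have h1 := hy t
  rw [clamp_of_mem (Set.Ioc_subset_Icc_self (Ioc_clamp_subset a b x hta))] at h1
  rw [norm_mul, Real.norm_eq_abs, Real.norm_eq_abs]
  gcongr

/-- The operator `y ↦ ∫ₐˣ ∫ₐˢ q y`. Solutions of `y'' = q y` on `[a, b]` with `y(a) = α` and
`y'(a) = β` are the solutions of `y = α + β (x - a) + volterra a b q y`. -/
noncomputable def volterra (a b : ℝ) (q : ℝ → ℝ) : (ℝ →ᵇ ℝ) →L[ℝ] (ℝ →ᵇ ℝ) :=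
  prim a b (fun _ => 1) * prim a b q

lemma volterra_pow_apply_le (hq : LocallyIntegrable q volume) {M : ℝ} (hM : ∀ᵐ x, |q x| ≤ M)
    (y : ℝ →ᵇ ℝ) (n : ℕ) (x : ℝ) :
    |(volterra a b q ^ n) y x| ≤ M ^ n * ‖y‖ / (2 * n).factorial * (clamp a b x - a) ^ (2 * n) := by
  induction n generalizing x with
  | zero => simpa using y.norm_coe_le_norm x
  | succ n ih =>
    rw [pow_succ']
    have h1 := abs_prim_apply_le hq hM ih
    have h2 := abs_prim_apply_le (M := 1) locallyIntegrable_one (by simp) h1 x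
    refine h2.trans (le_of_eq ?_)
    rw [show 2 * (n + 1) = 2 * n + 1 + 1 by ring, Nat.factorial_succ, Nat.factorial_succ]
    push_cast
    field_simp
    ring

lemma isUnit_one_sub_of_norm_pow_lt_one {R : Type*} [NormedRing R] [HasSummableGeomSeries R]
    {x : R} {n : ℕ} (h : ‖x ^ n‖ < 1) : IsUnit (1 - x) := by
  have hu := isUnit_one_sub_of_norm_lt_one h
  have hc : Commute (1 - x) (∑ i ∈ Finset.range n, x ^ i) :=
    Commute.sum_right _ _ _ fun i _ => (Commute.one_left _).sub_left (Commute.self_pow _ i)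
  rw [← mul_neg_geom_sum] at hu
  exact (hc.isUnit_mul_iff.1 hu).1

/-- A Volterra operator with bounded kernel is quasinilpotent. -/
lemma isUnit_one_sub_volterra (hq : MemLp q ⊤ volume) (hab : a ≤ b) :
    IsUnit (1 - volterra a b q) := by
  have hl := hq.locallyIntegrable le_top
  obtain ⟨M, hM⟩ : ∃ M : ℝ, ∀ᵐ x, |q x| ≤ M := by
    refine ⟨(eLpNorm q ⊤ volume).toReal, ?_⟩
    have := ae_le_eLpNormEssSup (f := q) (μ := volume)
    filter_upwards [this] with x hx
    have h2 := ENNReal.toReal_mono hq.2.ne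
      (show ‖q x‖ₑ ≤ eLpNorm q ⊤ volume by rwa [eLpNorm_exponent_top])
    rwa [toReal_enorm, Real.norm_eq_abs] at h2
  have hM0 : 0 ≤ M := by
    obtain ⟨x, hx⟩ := hM.exists
    exact (abs_nonneg _).trans hx
  have hlim := FloorSemiring.tendsto_pow_div_factorial_atTop (M * (b - a) ^ 2)
  obtain ⟨n, hn⟩ := (hlim.eventually (gt_mem_nhds zero_lt_one)).exists
  have hd : 0 ≤ b - a := sub_nonneg.2 hab
  have hnorm : ‖volterra a b q ^ n‖ < 1 := by
    refine lt_of_le_of_lt (ContinuousLinearMap.opNorm_le_bound _ ?_ fun y => ?_) hn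
    · positivity
    refine (BoundedContinuousFunction.norm_le (by positivity)).2 fun x => ?_
    refine (volterra_pow_apply_le hl hM y n x).trans ?_
    have h1 : (clamp a b x - a) ^ (2 * n) ≤ (b - a) ^ (2 * n) := by
      have := le_clamp a b x
      have := clamp_le hab x
      gcongr
    have h2 : ((n.factorial : ℕ) : ℝ) ≤ (2 * n).factorial := by
      exact_mod_cast Nat.factorial_le (by omega)
    have h3 : (0 : ℝ) < n.factorial := by exact_mod_cast n.factorial_pos
    have h4 : 0 ≤ clamp a b x - a := sub_nonneg.2 (le_clamp a b x)
    calc M ^ n * ‖y‖ / (2 * n).factorial * (clamp a b x - a) ^ (2 * n)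
        ≤ M ^ n * ‖y‖ / n.factorial * (b - a) ^ (2 * n) := by gcongr
      _ = _ := by rw [mul_pow, pow_mul]; ring
  exact isUnit_one_sub_of_norm_pow_lt_one (R := (ℝ →ᵇ ℝ) →L[ℝ] (ℝ →ᵇ ℝ)) hnorm

end

/-! ### Perturbation expansion of solutions and of the matching condition -/

section Expansion

lemma isBigO_clm_apply {α X : Type*} [NormedAddCommGroup X] [NormedSpace ℝ X] {l : Filter α}
    {P : α → X →L[ℝ] X} {F : α → X} {g h : α → ℝ} (hP : P =O[l] g) (hF : F =O[l] h) :
    (fun z => P z (F z)) =O[l] (fun z => g z * h z) := by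
  refine IsBigO.trans ?_ (hP.norm_left.mul hF.norm_left)
  exact IsBigO.of_bound 1 (Eventually.of_forall fun z => by
    simpa using (P z).le_opNorm (F z))

lemma isLittleO_clm_apply {α X : Type*} [NormedAddCommGroup X] [NormedSpace ℝ X] {l : Filter α}
    {P : α → X →L[ℝ] X} {F : α → X} {g h : α → ℝ} (hP : P =o[l] g) (hF : F =O[l] h) :
    (fun z => P z (F z)) =o[l] (fun z => g z * h z) := by
  refine IsBigO.trans_isLittleO ?_ (hP.norm_left.mul_isBigO hF.norm_left)
  exact IsBigO.of_bound 1 (Eventually.of_forall fun z => by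
    simpa using (P z).le_opNorm (F z))

/-- The filter along which the coupling constant and the square root `k` of minus the energy both
tend to `0` from the right. -/
abbrev smallParams : Filter (ℝ × ℝ) := 𝓝[>] 0 ×ˢ 𝓝[>] 0

lemma tendsto_fst_smallParams : Tendsto Prod.fst smallParams (𝓝[>] (0 : ℝ)) := tendsto_fst

lemma tendsto_snd_smallParams : Tendsto Prod.snd smallParams (𝓝[>] (0 : ℝ)) := tendsto_snd

lemma eventually_smallParams : ∀ᶠ z : ℝ × ℝ in smallParams,
    (0 < z.1 ∧ z.1 < 1) ∧ (0 < z.2 ∧ z.2 < 1) := by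
  have : ∀ᶠ x : ℝ in 𝓝[>] 0, 0 < x ∧ x < 1 := Ioo_mem_nhdsGT zero_lt_one
  exact (tendsto_fst_smallParams.eventually this).and (tendsto_snd_smallParams.eventually this)

variable {X : Type*} [NormedRing X] [NormedAlgebra ℝ X]
  {A J SU SV SW : X →L[ℝ] X} {E : ℝ → X →L[ℝ] X} {P : ℝ × ℝ → X →L[ℝ] X} {F : ℝ × ℝ → X}
  {e u v : X}

/- The expansion is pure operator algebra. Below `J` is integration, `SU`, `SV`, `SW` are integration
against `U`, `V`, `V₁`, the operator `E lam` is integration against `Vl - V - lam V₁`, and `P (lam, k)`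
is integration against `lam Vl + k²`. The inverse of `1 - J SU` is `A`, and `e` is `x - a`. -/

lemma perturbation_isBigO (hE : E =o[𝓝[>] 0] (fun lam : ℝ => lam))
    (hP : ∀ᶠ z in smallParams, P z = z.1 • (SV + z.1 • SW + E z.1) + z.2 ^ 2 • J) :
    P =O[smallParams] (fun z => z.1 + z.2) := by
  have hE1 : (fun z : ℝ × ℝ => E z.1) =O[smallParams] (fun _ => (1 : ℝ)) :=
    ((hE.comp_tendsto tendsto_fst_smallParams).isBigO.trans
      (IsBigO.of_bound 1 (eventually_smallParams.mono fun z hz => by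
        simp [abs_of_pos hz.1.1, hz.1.2.le])))
  have h1 : (fun z : ℝ × ℝ => z.1) =O[smallParams] (fun z => z.1 + z.2) :=
    IsBigO.of_bound 1 (eventually_smallParams.mono fun z hz => by
      rw [one_mul, Real.norm_of_nonneg hz.1.1.le, Real.norm_of_nonneg (by linarith)]
      linarith)
  have h1' : (fun z : ℝ × ℝ => z.1) =O[smallParams] (fun _ => (1 : ℝ)) :=
    IsBigO.of_bound 1 (eventually_smallParams.mono fun z hz => by
      rw [one_mul, Real.norm_of_nonneg hz.1.1.le, norm_one]
      linarith)
  have h2 : (fun z : ℝ × ℝ => z.2 ^ 2) =O[smallParams] (fun z => z.1 + z.2) :=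
    IsBigO.of_bound 1 (eventually_smallParams.mono fun z hz => by
      rw [one_mul, Real.norm_of_nonneg (sq_nonneg _), Real.norm_of_nonneg (by linarith)]
      nlinarith)
  have c : ∀ Q : X →L[ℝ] X, (fun _ : ℝ × ℝ => Q) =O[smallParams] (fun _ => (1 : ℝ)) :=
    fun Q => isBigO_const_const _ one_ne_zero _
  have hb : (fun z : ℝ × ℝ => SV + z.1 • SW + E z.1) =O[smallParams] (fun _ => (1 : ℝ)) := by
    refine ((c SV).add ?_).add hE1
    simpa using h1'.smul (c SW)
  refine IsBigO.congr' (f₁ := fun z => z.1 • (SV + z.1 • SW + E z.1) + z.2 ^ 2 • J) ?_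
    (hP.mono fun z hz => hz.symm) EventuallyEq.rfl
  refine IsBigO.add ?_ ?_
  · simpa using h1.smul hb
  · simpa using h2.smul (c J)

/-- First order perturbation of the solution. -/
lemma solution_sub_isBigO (hA : ∀ x, A (x - J (SU x)) = x)
    (hPO : P =O[smallParams] (fun z => z.1 + z.2))
    (hF : ∀ᶠ z in smallParams, F z = 1 + z.2 • e + J (SU (F z)) + J (P z (F z)))
    (hu : u = 1 + J (SU u)) :
    F =O[smallParams] (fun _ => (1 : ℝ)) ∧
    (fun z => F z - u) =O[smallParams] (fun z => z.1 + z.2) := by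
  have hAu : A 1 = u := by rw [← hA u, ← eq_sub_iff_add_eq.2 hu.symm]
  have hdiff : ∀ᶠ z in smallParams, F z = u + A (z.2 • e + J (P z (F z))) := by
    filter_upwards [hF] with z hz
    rw [← hAu, ← map_add, ← hA (F z)]
    congr 1
    rw [hA, sub_eq_iff_eq_add]
    nth_rw 1 [hz]
    abel
  have hsum : Tendsto (fun z : ℝ × ℝ => z.1 + z.2) smallParams (𝓝 0) := by
    simpa using (tendsto_fst_smallParams.mono_right nhdsWithin_le_nhds).add
      (tendsto_snd_smallParams.mono_right nhdsWithin_le_nhds)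
  have hPsmall : ∀ᶠ z in smallParams, ‖A‖ * (‖J‖ * ‖P z‖) ≤ 1 / 2 := by
    have h0 : Tendsto (fun z => ‖A‖ * (‖J‖ * ‖P z‖)) smallParams (𝓝 0) := by
      simpa using ((hPO.trans_tendsto hsum).norm.const_mul ‖J‖).const_mul ‖A‖
    exact h0.eventually (ge_mem_nhds (by norm_num))
  have hFO : F =O[smallParams] (fun _ => (1 : ℝ)) := by
    refine IsBigO.of_bound (2 * (‖u‖ + ‖A‖ * ‖e‖)) ?_
    filter_upwards [hdiff, hPsmall, eventually_smallParams] with z h1 h2 h3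
    have h4 : ‖F z‖ ≤ ‖u‖ + ‖A‖ * (‖e‖ + ‖J‖ * (‖P z‖ * ‖F z‖)) := by
      conv_lhs => rw [h1]
      refine (norm_add_le _ _).trans ?_
      gcongr
      refine (A.le_opNorm _).trans ?_
      gcongr
      refine (norm_add_le _ _).trans ?_
      gcongr
      · rw [norm_smul, Real.norm_of_nonneg h3.2.1.le]
        exact mul_le_of_le_one_left (norm_nonneg _) h3.2.2.le
      · refine (J.le_opNorm _).trans ?_
        gcongr
        exact (P z).le_opNorm _
    have h5 : ‖A‖ * (‖J‖ * ‖P z‖) * ‖F z‖ ≤ 1 / 2 * ‖F z‖ := by gcongr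
    rw [norm_one, mul_one]
    linarith
  refine ⟨hFO, ?_⟩
  have h2 : (fun z : ℝ × ℝ => z.2) =O[smallParams] (fun z => z.1 + z.2) :=
    IsBigO.of_bound 1 (eventually_smallParams.mono fun z hz => by
      rw [one_mul, Real.norm_of_nonneg hz.2.1.le, Real.norm_of_nonneg (by linarith)]
      linarith)
  refine IsBigO.congr' (f₁ := fun z => A (z.2 • e + J (P z (F z)))) ?_
    (hdiff.mono fun z hz => by rw [← sub_eq_iff_eq_add'] at hz; exact hz.symm) EventuallyEq.rfl
  refine (A.isBigO_comp _ _).trans (IsBigO.add ?_ ?_)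
  · simpa using h2.smul (isBigO_const_const e (one_ne_zero (α := ℝ)) _)
  · refine (J.isBigO_comp _ _).trans ?_
    simpa using isBigO_clm_apply hPO hFO

/-- Second order perturbation of the solution: the term of order `lam` is `lam v`. -/
lemma solution_sub_sub_isBigO (hA : ∀ x, A (x - J (SU x)) = x)
    (hE : E =o[𝓝[>] 0] (fun lam : ℝ => lam))
    (hP : ∀ᶠ z in smallParams, P z = z.1 • (SV + z.1 • SW + E z.1) + z.2 ^ 2 • J)
    (hF : ∀ᶠ z in smallParams, F z = 1 + z.2 • e + J (SU (F z)) + J (P z (F z)))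
    (hu : u = 1 + J (SU u)) (hv : v = J (SU v) + J (SV u)) :
    (fun z => F z - u - z.1 • v) =O[smallParams] (fun z => z.2 + z.1 ^ 2) := by
  obtain ⟨hF1, hFu⟩ := solution_sub_isBigO hA (perturbation_isBigO hE hP) hF hu
  have hdiff : ∀ᶠ z in smallParams, A (z.2 • e + J (z.1 • SV (F z - u) +
      z.1 • (z.1 • SW (F z) + E z.1 (F z)) + z.2 ^ 2 • J (F z))) = F z - u - z.1 • v := by
    filter_upwards [hF, hP] with z hz hPz
    rw [← hA (F z - u - z.1 • v)]
    congr 1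
    nth_rw 5 [hz]
    nth_rw 2 [hu]
    nth_rw 1 [hv]
    rw [hPz]
    simp only [map_sub, map_add, map_smul, add_apply, smul_apply, smul_add, smul_sub]
    abel
  have h2 : (fun z : ℝ × ℝ => z.2) =O[smallParams] (fun z => z.2 + z.1 ^ 2) :=
    IsBigO.of_bound 1 (eventually_smallParams.mono fun z hz => by
      rw [one_mul, Real.norm_of_nonneg hz.2.1.le, Real.norm_of_nonneg (by nlinarith)]
      nlinarith)
  have h22 : (fun z : ℝ × ℝ => z.2 ^ 2) =O[smallParams] (fun z => z.2 + z.1 ^ 2) :=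
    IsBigO.of_bound 1 (eventually_smallParams.mono fun z hz => by
      rw [one_mul, Real.norm_of_nonneg (by nlinarith), Real.norm_of_nonneg (by nlinarith)]
      nlinarith)
  have h11 : (fun z : ℝ × ℝ => z.1 * z.1) =O[smallParams] (fun z => z.2 + z.1 ^ 2) :=
    IsBigO.of_bound 1 (eventually_smallParams.mono fun z hz => by
      rw [one_mul, Real.norm_of_nonneg (by nlinarith), Real.norm_of_nonneg (by nlinarith)]
      nlinarith)
  have h112 : (fun z : ℝ × ℝ => z.1 * (z.1 + z.2)) =O[smallParams] (fun z => z.2 + z.1 ^ 2) :=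
    IsBigO.of_bound 1 (eventually_smallParams.mono fun z hz => by
      rw [one_mul, Real.norm_of_nonneg (by nlinarith), Real.norm_of_nonneg (by nlinarith)]
      nlinarith)
  refine IsBigO.congr' ?_ hdiff EventuallyEq.rfl
  refine (A.isBigO_comp _ _).trans (IsBigO.add ?_ ((J.isBigO_comp _ _).trans
    (IsBigO.add (IsBigO.add ?_ ?_) ?_)))
  · simpa using h2.smul (isBigO_const_const e (one_ne_zero (α := ℝ)) _)
  · refine IsBigO.trans ?_ h112
    simpa using (isBigO_refl (fun z : ℝ × ℝ => z.1) smallParams).smul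
      ((SV.isBigO_comp _ _).trans hFu)
  · refine IsBigO.trans ?_ h11
    refine (isBigO_refl (fun z : ℝ × ℝ => z.1) smallParams).smul (IsBigO.add ?_ ?_)
    · simpa using (isBigO_refl (fun z : ℝ × ℝ => z.1) smallParams).smul
        ((SW.isBigO_comp _ _).trans hF1)
    · simpa using isBigO_clm_apply (hE.comp_tendsto tendsto_fst_smallParams).isBigO hF1
  · simpa using h22.smul ((J.isBigO_comp _ _).trans hF1)

/-- Expansion of the matching condition: with the vanishing first order term, what remains is
`k (1 + θ²) + lam² I`, up to `o(k + lam²)`. -/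
lemma matching_isLittleO (ev : X →L[ℝ] ℝ) {θ : ℝ} (hθ : ev u = θ)
    (hA : ∀ x, A (x - J (SU x)) = x)
    (hE : E =o[𝓝[>] 0] (fun lam : ℝ => lam))
    (hP : ∀ᶠ z in smallParams, P z = z.1 • (SV + z.1 • SW + E z.1) + z.2 ^ 2 • J)
    (hF : ∀ᶠ z in smallParams, F z = 1 + z.2 • e + J (SU (F z)) + J (P z (F z)))
    (hu : u = 1 + J (SU u)) (hv : v = J (SU v) + J (SV u)) (h0 : ev (SV (u * u)) = 0) :
    (fun z => z.2 + ev (P z (F z * u)) + z.2 * θ * ev (F z) -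
      (z.2 * (1 + θ ^ 2) + z.1 ^ 2 * (ev (SV (v * u)) + ev (SW (u * u)))))
      =o[smallParams] (fun z => z.2 + z.1 ^ 2) := by
  obtain ⟨hF1, hFu⟩ := solution_sub_isBigO hA (perturbation_isBigO hE hP) hF hu
  have hFv := solution_sub_sub_isBigO hA hE hP hF hu hv
  have heq : ∀ᶠ z in smallParams, (z.2 * θ) * ev (F z - u) +
      z.1 * ev (SV ((F z - u - z.1 • v) * u)) + z.1 ^ 2 * ev (SW ((F z - u) * u)) +
      z.1 * ev (E z.1 (F z * u)) + z.2 ^ 2 * ev (J (F z * u)) =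
      z.2 + ev (P z (F z * u)) + z.2 * θ * ev (F z) -
      (z.2 * (1 + θ ^ 2) + z.1 ^ 2 * (ev (SV (v * u)) + ev (SW (u * u)))) := by
    filter_upwards [hP] with z hz
    rw [hz]
    simp only [sub_mul, smul_mul_assoc, map_sub, map_add, map_smul, add_apply, smul_apply, h0, hθ,
      smul_eq_mul]
    ring
  refine IsLittleO.congr' ?_ heq EventuallyEq.rfl
  have one1 : (fun z : ℝ × ℝ => z.1) =o[smallParams] (fun _ => (1 : ℝ)) :=
    (isLittleO_one_iff ℝ).2 (tendsto_fst_smallParams.mono_right nhdsWithin_le_nhds)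
  have one2 : (fun z : ℝ × ℝ => z.2) =o[smallParams] (fun _ => (1 : ℝ)) :=
    (isLittleO_one_iff ℝ).2 (tendsto_snd_smallParams.mono_right nhdsWithin_le_nhds)
  have g2 : (fun z : ℝ × ℝ => z.2) =O[smallParams] (fun z => z.2 + z.1 ^ 2) :=
    IsBigO.of_bound 1 (eventually_smallParams.mono fun z hz => by
      rw [one_mul, Real.norm_of_nonneg hz.2.1.le, Real.norm_of_nonneg (by nlinarith)]
      nlinarith)
  have g1 : (fun z : ℝ × ℝ => z.1 ^ 2) =O[smallParams] (fun z => z.2 + z.1 ^ 2) :=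
    IsBigO.of_bound 1 (eventually_smallParams.mono fun z hz => by
      rw [one_mul, Real.norm_of_nonneg (by nlinarith), Real.norm_of_nonneg (by nlinarith)]
      nlinarith)
  have hFuo : (fun z => F z - u) =o[smallParams] (fun _ => (1 : ℝ)) :=
    hFu.trans_isLittleO (one1.add one2)
  have mu : ∀ {G : ℝ × ℝ → X} {h : ℝ × ℝ → ℝ}, G =O[smallParams] h →
      (fun z => G z * u) =O[smallParams] h := fun hG => by
    simpa using hG.mul (isBigO_const_const u (one_ne_zero (α := ℝ)) _)
  refine ((((?_ : IsLittleO _ _ _).add ?_).add ?_).add ?_).add ?_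
  · have : (fun z : ℝ × ℝ => z.2 * θ) =O[smallParams] (fun z => z.2 + z.1 ^ 2) := by
      simpa using g2.mul (isBigO_const_const θ (one_ne_zero (α := ℝ)) _)
    simpa using this.mul_isLittleO ((ev.isBigO_comp _ _).trans_isLittleO hFuo)
  · simpa using one1.mul_isBigO (((ev.isBigO_comp _ _).trans (SV.isBigO_comp _ _)).trans (mu hFv))
  · have h3 : (fun z => (F z - u) * u) =o[smallParams] (fun _ => (1 : ℝ)) := by
      simpa using hFuo.mul_isBigO (isBigO_const_const u (one_ne_zero (α := ℝ)) _)
    simpa using g1.mul_isLittleO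
      (((ev.isBigO_comp _ _).trans (SW.isBigO_comp _ _)).trans_isLittleO h3)
  · refine IsLittleO.trans_isBigO ?_ g1
    have h3 := isLittleO_clm_apply (hE.comp_tendsto tendsto_fst_smallParams) (mu hF1)
    simpa [pow_two, Function.comp_def] using
      (isBigO_refl (fun z : ℝ × ℝ => z.1) smallParams).mul_isLittleO
        ((ev.isBigO_comp _ _).trans_isLittleO h3)
  · have h3 : (fun z : ℝ × ℝ => z.2 ^ 2) =o[smallParams] (fun z => z.2 + z.1 ^ 2) := by
      simpa [pow_two] using one2.mul_isBigO g2
    simpa using h3.mul_isBigO (((ev.isBigO_comp _ _).trans (J.isBigO_comp _ _)).trans (mu hF1))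

end Expansion

/-! ### Solutions on the line and their restriction to an interval -/

section Clamped
variable {a b : ℝ}

lemma exists_clamped (hab : a ≤ b) {f : ℝ → ℝ} (hf : Continuous f) :
    ∃ F : ℝ →ᵇ ℝ, ∀ x, F x = f (clamp a b x) := by
  obtain ⟨C, hC⟩ := isCompact_Icc.exists_bound_of_continuousOn (s := Set.Icc a b) hf.continuousOn
  exact ⟨BoundedContinuousFunction.ofNormedAddCommGroup (fun x => f (clamp a b x))
    (hf.comp (continuous_clamp a b)) C fun x => hC _ ⟨le_clamp a b x, clamp_le hab x⟩, fun x => rfl⟩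

lemma ac_eq_add_integral {f g : ℝ → ℝ} {c d : ℝ} (hf : AbsolutelyContinuousOnInterval f c d)
    (hg : ∀ᵐ t, t ∈ Set.uIoc c d → deriv f t = g t) : f d = f c + ∫ t in c..d, g t := by
  rw [← intervalIntegral.integral_congr_ae hg, hf.integral_deriv_eq_sub]
  ring

lemma IsSolution.continuous_deriv {U f y : ℝ → ℝ} (h : IsSolution U f y) :
    Continuous (deriv y) := by
  refine continuous_iff_continuousAt.2 fun x => ?_
  refine (h.2.1 (x - 1) (x + 1)).continuousOn.continuousAt ?_
  rw [Set.uIcc_of_le (by linarith)]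
  exact Icc_mem_nhds (by linarith) (by linarith)

lemma IsSolution.eq_add_integral {U f y : ℝ → ℝ} (h : IsSolution U f y) (c d : ℝ) :
    y d = y c + ∫ t in c..d, deriv y t := by
  rw [intervalIntegral.integral_deriv_eq_sub (fun x _ => h.1 x)
    (h.continuous_deriv.intervalIntegrable _ _)]
  ring

lemma IsSolution.deriv_eq_add_integral {U f y : ℝ → ℝ} (h : IsSolution U f y) (c d : ℝ) :
    deriv y d = deriv y c + ∫ t in c..d, (U t * y t - f t) :=
  ac_eq_add_integral (h.2.1 c d) (h.2.2.mono fun t ht _ => by linarith)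

/-- A solution restricted to `[a, b]`, together with its derivative, solves the integral form of
the first order system. -/
lemma IsSolution.exists_clamped (hab : a ≤ b) {U f y : ℝ → ℝ} (h : IsSolution U f y) :
    ∃ Y Y' : ℝ →ᵇ ℝ, (∀ x, Y x = y (clamp a b x)) ∧ (∀ x, Y' x = deriv y (clamp a b x)) ∧
      Y = y a • 1 + prim a b (fun _ => 1) Y' ∧
      ∀ x, Y' x = deriv y a + ∫ t in a..clamp a b x, (U t * Y t - f t) := by
  obtain ⟨Y, hY⟩ := _root_.exists_clamped hab h.1.continuous
  obtain ⟨Y', hY'⟩ := _root_.exists_clamped hab h.continuous_deriv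
  have hin : ∀ x, ∀ t ∈ Set.uIcc a (clamp a b x), clamp a b t = t := fun x t ht => by
    rw [Set.uIcc_of_le (le_clamp a b x)] at ht
    exact clamp_of_mem ⟨ht.1, ht.2.trans (clamp_le hab x)⟩
  refine ⟨Y, Y', hY, hY', ?_, fun x => ?_⟩
  · ext x
    simp only [BoundedContinuousFunction.coe_add, Pi.add_apply,
      BoundedContinuousFunction.coe_smul, smul_eq_mul, BoundedContinuousFunction.coe_one,
      Pi.one_apply, mul_one, prim_apply locallyIntegrable_one, one_mul]
    rw [hY, h.eq_add_integral a (clamp a b x)]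
    congr 1
    exact intervalIntegral.integral_congr fun t ht => by simp only [hY', hin x t ht]
  · rw [hY', h.deriv_eq_add_integral a]
    congr 1
    exact intervalIntegral.integral_congr fun t ht => by simp only [hY, hin x t ht]

/-- A solution of the homogeneous equation in terms of `prim`. -/
lemma IsSolution.exists_clamped_zero (hab : a ≤ b) {U y : ℝ → ℝ} (hU : LocallyIntegrable U volume)
    (h : IsSolution U 0 y) :
    ∃ Y Y' : ℝ →ᵇ ℝ, (∀ x, Y x = y (clamp a b x)) ∧ (∀ x, Y' x = deriv y (clamp a b x)) ∧
      Y = y a • 1 + prim a b (fun _ => 1) Y' ∧ Y' = deriv y a • 1 + prim a b U Y := by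
  obtain ⟨Y, Y', hY, hY', h1, h2⟩ := h.exists_clamped hab
  refine ⟨Y, Y', hY, hY', h1, ?_⟩
  ext x
  rw [h2]
  simp [prim_apply hU]

lemma IsSolution.affine {U f y : ℝ → ℝ} (h : IsSolution U f y) {c x : ℝ}
    (h0 : ∀ᵐ t, t ∈ Set.uIoc c x → U t = 0 ∧ f t = 0) :
    y x = y c + deriv y c * (x - c) := by
  rw [h.eq_add_integral c x]
  congr 1
  have : ∀ t ∈ Set.uIcc c x, deriv y t = deriv y c := by
    intro t ht
    rw [h.deriv_eq_add_integral c t, intervalIntegral.integral_zero_ae, add_zero]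
    filter_upwards [h0] with s hs hst
    have := hs (Set.uIoc_subset_uIoc_of_uIcc_subset_uIcc (Set.uIcc_subset_uIcc_left ht) hst)
    simp [this.1, this.2]
  rw [intervalIntegral.integral_congr this]
  simp [mul_comm]

/-- Where the potential equals `κ²`, the combination `y' - κ y` of a solution is a multiple of
`exp (-κ x)`. -/
lemma IsSolution.deriv_sub_mul {W y : ℝ → ℝ} (h : IsSolution W 0 y) {κ c x : ℝ}
    (h0 : ∀ᵐ t, t ∈ Set.uIoc c x → W t = κ ^ 2) :
    deriv y x - κ * y x = (deriv y c - κ * y c) * Real.exp (-κ * (x - c)) := by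
  have hy1 : ContDiff ℝ 1 y := contDiff_one_iff_deriv.2 ⟨h.1, h.continuous_deriv⟩
  have hA : AbsolutelyContinuousOnInterval (fun t => (deriv y t - κ * y t) * Real.exp (κ * t)) c x :=
    ((h.2.1 c x).fun_sub ((hy1.contDiffOn.absolutelyContinuousOnInterval).const_mul κ)).fun_mul
      (ContDiffOn.absolutelyContinuousOnInterval (by fun_prop))
  have key := ac_eq_add_integral (g := fun _ => 0) hA (by
    filter_upwards [h0, h.2.2, (h.2.1 c x).ae_differentiableAt] with t h1 h2 h3 ht
    have d1 := (h3 (Set.uIoc_subset_uIcc ht)).hasDerivAt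
    have d2 := (h.1 t).hasDerivAt
    have d3 : HasDerivAt (fun t => Real.exp (κ * t)) (Real.exp (κ * t) * κ) t := by
      simpa using ((hasDerivAt_id t).const_mul κ).exp
    rw [((d1.fun_sub (d2.const_mul κ)).fun_mul d3).deriv]
    have : deriv (deriv y) t = κ ^ 2 * y t := by
      rw [← h1 ht]; simp only [Pi.zero_apply] at h2; linarith
    rw [this]
    ring)
  simp only [intervalIntegral.integral_zero, add_zero] at key
  have hne := (Real.exp_pos (κ * x)).ne'
  rw [← mul_left_inj' hne, key, mul_assoc, ← Real.exp_add]
  congr 2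
  ring

/-- A square integrable solution decays like `exp (k x)` to the left of the support of the
potential, so it satisfies the corresponding Robin condition there. -/
lemma IsSolution.robin_left {W y : ℝ → ℝ} (h : IsSolution W 0 y) {k : ℝ} (hk : 0 < k)
    (h0 : ∀ᵐ t, t < a → W t = k ^ 2) (hy : MemLp y 2 volume) (hy' : MemLp (deriv y) 2 volume) :
    ∀ x ≤ a, y x = y a * Real.exp (k * (x - a)) ∧ deriv y x = k * y x := by
  have hsub : ∀ x ≤ a, ∀ᵐ t, t ∈ Set.uIoc a x → W t = k ^ 2 := by
    intro x hx
    filter_upwards [h0, Measure.ae_ne volume a] with t ht hta hmem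
    rw [Set.uIoc_of_ge hx] at hmem
    exact ht (lt_of_le_of_ne hmem.2 hta)
  have hw : MemLp (fun x => deriv y x - k * y x) 2 volume := hy'.sub (hy.const_mul k)
  have hexp : ∀ x ≤ a, deriv y x - k * y x = (deriv y a - k * y a) * Real.exp (-k * (x - a)) :=
    fun x hx => h.deriv_sub_mul (hsub x hx)
  have hz : deriv y a - k * y a = 0 := by
    by_contra hne
    have hi := hw.integrable_sq.integrableOn (s := Set.Iic a)
    have hc : IntegrableOn (fun _ : ℝ => (deriv y a - k * y a) ^ 2) (Set.Iic a) := by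
      refine Integrable.mono' hi aestronglyMeasurable_const ?_
      filter_upwards [ae_restrict_mem measurableSet_Iic] with x hx
      rw [hexp x hx, Real.norm_of_nonneg (sq_nonneg _), mul_pow]
      refine le_mul_of_one_le_right (sq_nonneg _) (one_le_pow₀ (Real.one_le_exp ?_))
      have : x ≤ a := hx
      nlinarith
    rw [integrableOn_const_iff] at hc
    simp [hne] at hc
  intro x hx
  have e1 := hexp x hx
  have e2 := h.deriv_sub_mul (κ := -k) (c := a) (x := x) (by simpa using hsub x hx)
  rw [hz, zero_mul] at e1
  have hr : deriv y x = k * y x := by linarith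
  refine ⟨?_, hr⟩
  rw [neg_neg, hr, show deriv y a = k * y a by linarith] at e2
  have : (2 * k) * y x = (2 * k) * (y a * Real.exp (k * (x - a))) := by linarith
  exact mul_left_cancel₀ (by positivity) this

lemma IsSolution.robin_right {W y : ℝ → ℝ} (h : IsSolution W 0 y) {k : ℝ} (hk : 0 < k)
    (h0 : ∀ᵐ t, b < t → W t = k ^ 2) (hy : MemLp y 2 volume) (hy' : MemLp (deriv y) 2 volume) :
    ∀ x ≥ b, y x = y b * Real.exp (-k * (x - b)) ∧ deriv y x = -k * y x := by
  have hsub : ∀ x ≥ b, ∀ᵐ t, t ∈ Set.uIoc b x → W t = k ^ 2 := by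
    intro x hx
    filter_upwards [h0] with t ht hmem
    rw [Set.uIoc_of_le hx] at hmem
    exact ht hmem.1
  have hw : MemLp (fun x => deriv y x + k * y x) 2 volume := hy'.add (hy.const_mul k)
  have hexp : ∀ x ≥ b, deriv y x + k * y x = (deriv y b + k * y b) * Real.exp (k * (x - b)) := by
    intro x hx
    have := h.deriv_sub_mul (κ := -k) (c := b) (x := x) (by simpa using hsub x hx)
    simpa using this
  have hz : deriv y b + k * y b = 0 := by
    by_contra hne
    have hi := hw.integrable_sq.integrableOn (s := Set.Ici b)
    have hc : IntegrableOn (fun _ : ℝ => (deriv y b + k * y b) ^ 2) (Set.Ici b) := by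
      refine Integrable.mono' hi aestronglyMeasurable_const ?_
      filter_upwards [ae_restrict_mem measurableSet_Ici] with x hx
      rw [hexp x hx, Real.norm_of_nonneg (sq_nonneg _), mul_pow]
      refine le_mul_of_one_le_right (sq_nonneg _) (one_le_pow₀ (Real.one_le_exp ?_))
      have : b ≤ x := hx
      nlinarith
    rw [integrableOn_const_iff] at hc
    simp [hne] at hc
  intro x hx
  have e1 := hexp x hx
  have e2 := h.deriv_sub_mul (κ := k) (c := b) (x := x) (hsub x hx)
  rw [hz, zero_mul] at e1
  have hr : deriv y x = -k * y x := by linarith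
  refine ⟨?_, hr⟩
  rw [hr, show deriv y b = -k * y b by linarith] at e2
  have : (2 * k) * y x = (2 * k) * (y b * Real.exp (-k * (x - b))) := by linarith
  exact mul_left_cancel₀ (by positivity) this

end Clamped

/-! ### The Jost solution and its mismatch at an eigenvalue -/

section Jost
variable {a b k : ℝ} {q : ℝ → ℝ}

/-- The solution on `[a, b]` of `-y'' + (q + k²) y = 0` with `y(a) = 1` and `y'(a) = k`, which
continues `exp (k (x - a))` when `q` vanishes to the left of `a`. -/
noncomputable def jost (a b : ℝ) (q : ℝ → ℝ) (k : ℝ) : ℝ →ᵇ ℝ :=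
  Ring.inverse (1 - volterra a b (fun x => q x + k ^ 2))
    (1 + k • prim a b (fun _ => 1) 1)

/-- The derivative of `jost a b q k` on `[a, b]`. -/
noncomputable def jostDeriv (a b : ℝ) (q : ℝ → ℝ) (k : ℝ) : ℝ →ᵇ ℝ :=
  k • 1 + prim a b (fun x => q x + k ^ 2) (jost a b q k)

/-- The mismatch at `b` of `jost a b q k` with the decaying exponential `exp (-k x)`. -/
noncomputable def mismatch (a b : ℝ) (q : ℝ → ℝ) (k : ℝ) : ℝ :=
  jostDeriv a b q k b + k * jost a b q k b

lemma memLp_top_add_const (hq : MemLp q ⊤ volume) (c : ℝ) :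
    MemLp (fun x => q x + c) ⊤ volume :=
  hq.add (memLp_top_const c)

lemma inverse_apply_apply {X : Type*} [NormedAddCommGroup X] [NormedSpace ℝ X] {B : X →L[ℝ] X}
    (hB : IsUnit B) (x : X) : Ring.inverse B (B x) = x :=
  DFunLike.congr_fun (Ring.inverse_mul_cancel B hB) x

lemma apply_inverse_apply {X : Type*} [NormedAddCommGroup X] [NormedSpace ℝ X] {B : X →L[ℝ] X}
    (hB : IsUnit B) (x : X) : B (Ring.inverse B x) = x :=
  DFunLike.congr_fun (Ring.mul_inverse_cancel B hB) x

/-- The Jost solution is the unique solution of its Volterra equation. -/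
lemma jost_eq_iff (hq : MemLp q ⊤ volume) (hab : a ≤ b) {y : ℝ →ᵇ ℝ} :
    y = jost a b q k ↔ y = 1 + k • prim a b (fun _ => 1) 1 +
      volterra a b (fun x => q x + k ^ 2) y := by
  have hu := isUnit_one_sub_volterra (memLp_top_add_const hq (k ^ 2)) hab
  rw [← sub_eq_iff_eq_add]
  constructor
  · intro h
    have := apply_inverse_apply hu (1 + k • prim a b (fun _ => 1) 1)
    rw [← jost, ← h] at this
    exact this
  · intro h
    rw [jost, ← h]
    exact (inverse_apply_apply hu y).symm

lemma jost_eq (hq : MemLp q ⊤ volume) (hab : a ≤ b) :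
    jost a b q k = 1 + prim a b (fun _ => 1) (jostDeriv a b q k) := by
  have := (jost_eq_iff (k := k) hq hab).1 rfl
  rw [jostDeriv, map_add, map_smul, ← add_assoc]
  exact this

lemma continuous_add_sq_smul {E : Type*} [NormedAddCommGroup E] [NormedSpace ℝ E] (x y : E) :
    Continuous fun k : ℝ => x + k ^ 2 • y := by
  fun_prop

lemma continuous_inverse_one_sub {R : Type*} [NormedRing R] [HasSummableGeomSeries R]
    [NormedAlgebra ℝ R] (J Q : R) (h : ∀ k : ℝ, IsUnit (1 - J * (Q + k ^ 2 • J))) :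
    Continuous fun k : ℝ => Ring.inverse (1 - J * (Q + k ^ 2 • J)) := by
  refine continuous_iff_continuousAt.2 fun k => ?_
  obtain ⟨U, hU⟩ := h k
  have h1 := NormedRing.inverse_continuousAt U
  rw [hU] at h1
  exact ContinuousAt.comp (f := fun k : ℝ => 1 - J * (Q + k ^ 2 • J)) h1 (by fun_prop)

lemma continuous_mismatch (hq : MemLp q ⊤ volume) (hab : a ≤ b) :
    Continuous (mismatch a b q) := by
  have hp : ∀ k : ℝ, prim a b (fun x => q x + k ^ 2) =
      prim a b q + k ^ 2 • prim a b (fun _ => 1) := fun k => by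
    rw [prim_add (hq.locallyIntegrable le_top) continuous_const.locallyIntegrable, prim_const]
  have hpc : Continuous fun k : ℝ => prim a b (fun x => q x + k ^ 2) := by
    simp only [hp]
    exact continuous_add_sq_smul (E := (ℝ →ᵇ ℝ) →L[ℝ] (ℝ →ᵇ ℝ)) _ _
  have hic : Continuous fun k : ℝ =>
      Ring.inverse (1 - volterra a b (fun x => q x + k ^ 2)) := by
    have h := fun k : ℝ => isUnit_one_sub_volterra (memLp_top_add_const hq (k ^ 2)) hab
    simp only [volterra, hp] at h ⊢
    exact continuous_inverse_one_sub (R := (ℝ →ᵇ ℝ) →L[ℝ] (ℝ →ᵇ ℝ)) _ _ h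
  have hjc : Continuous (jost a b q) := hic.clm_apply (by fun_prop)
  have hdc : Continuous (jostDeriv a b q) := by
    unfold jostDeriv
    exact (continuous_id.smul continuous_const).add (hpc.clm_apply hjc)
  have he : Continuous fun f : ℝ →ᵇ ℝ => f b :=
    (BoundedContinuousFunction.evalCLM ℝ b).continuous
  exact (he.comp hdc).add (continuous_id.mul (he.comp hjc))

/-- Every solution with `y'(a) = k y(a)` is a multiple of the Jost solution. -/
lemma eq_smul_jost (hq : MemLp q ⊤ volume) (hab : a ≤ b) {y y' : ℝ →ᵇ ℝ} {c : ℝ}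
    (hy : y = c • 1 + prim a b (fun _ => 1) y')
    (hy' : y' = (k * c) • 1 + prim a b (fun x => q x + k ^ 2) y) :
    y = c • jost a b q k ∧ y' = c • jostDeriv a b q k := by
  have hu := isUnit_one_sub_volterra (memLp_top_add_const hq (k ^ 2)) hab
  have h1 : y = c • jost a b q k := by
    rw [jost, ← map_smul, ← inverse_apply_apply hu y]
    congr 1
    rw [sub_apply, sub_eq_iff_eq_add]
    nth_rw 1 [hy]
    rw [hy']
    simp only [map_add, map_smul, volterra, smul_add, smul_smul, mul_comm k c,
      mul_apply_eq_comp, one_apply_eq_self]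
    abel
  refine ⟨h1, ?_⟩
  rw [hy', h1, jostDeriv, map_smul, smul_add, smul_smul, mul_comm]

/-- Matching a square integrable real solution at both ends of the support of the potential. -/
lemma mismatch_eq_zero_of_isSolution (hq : MemLp q ⊤ volume) (hab : a ≤ b) (hk : 0 < k)
    (h0 : ∀ᵐ x, x ∉ Set.Icc a b → q x = 0) {y : ℝ → ℝ}
    (h : IsSolution (fun x => q x + k ^ 2) 0 y) (hne : y ≠ 0)
    (hy : MemLp y 2 volume) (hy' : MemLp (deriv y) 2 volume) : mismatch a b q k = 0 := by
  have hleft := h.robin_left (a := a) hk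
    (h0.mono fun t ht hta => by simp [ht fun hm => absurd hta (not_lt.2 hm.1)]) hy hy'
  have hright := h.robin_right (b := b) hk
    (h0.mono fun t ht hta => by simp [ht fun hm => absurd hta (not_lt.2 hm.2)]) hy hy'
  obtain ⟨Y, Y', hY, hY', h1, h2⟩ := h.exists_clamped_zero hab
    ((memLp_top_add_const hq (k ^ 2)).locallyIntegrable le_top)
  rw [(hleft a le_rfl).2] at h2
  obtain ⟨e1, e2⟩ := eq_smul_jost hq hab h1 h2
  have v1 : y b = y a * jost a b q k b := by
    have := hY b
    rw [e1, clamp_right hab] at this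
    exact this.symm
  have v2 : deriv y b = y a * jostDeriv a b q k b := by
    have := hY' b
    rw [e2, clamp_right hab] at this
    exact this.symm
  have hya : y a ≠ 0 := by
    intro hya
    refine hne (funext fun x => ?_)
    rw [Pi.zero_apply]
    rcases le_total x a with hx | hx
    · rw [(hleft x hx).1, hya, zero_mul]
    rcases le_total b x with hx' | hx'
    · rw [(hright x hx').1, v1, hya, zero_mul, zero_mul]
    · rw [← clamp_of_mem ⟨hx, hx'⟩, ← hY, e1, hya, zero_smul]; rfl
  have := (hright b le_rfl).2
  rw [v1, v2] at this
  have hprod : y a * mismatch a b q k = 0 := by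
    rw [mismatch]
    linarith
  exact (mul_eq_zero.1 hprod).resolve_left hya

lemma AbsolutelyContinuousOnInterval.clm_comp {E G : Type*} [NormedAddCommGroup E]
    [NormedSpace ℝ E] [NormedAddCommGroup G] [NormedSpace ℝ G] {f : ℝ → E} {c d : ℝ}
    (hf : AbsolutelyContinuousOnInterval f c d) (L : E →L[ℝ] G) :
    AbsolutelyContinuousOnInterval (fun x => L (f x)) c d := by
  refine squeeze_zero (fun t => Finset.sum_nonneg fun i _ => dist_nonneg) (fun t => ?_)
    (by simpa using Tendsto.const_mul ‖L‖ hf)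
  rw [Finset.mul_sum]
  exact Finset.sum_le_sum fun i _ => L.lipschitz.dist_le_mul _ _

/-- The real part of a suitable multiple of a complex eigenfunction is a nonzero real one. -/
lemma mismatch_eq_zero_of_eigenvalue (hq : MemLp q ⊤ volume) (hab : a ≤ b) (hk : 0 < k)
    (h0 : ∀ᵐ x, x ∉ Set.Icc a b → q x = 0) (h : IsSchrodingerEigenvalue q (-k ^ 2)) :
    mismatch a b q k = 0 := by
  obtain ⟨ψ, ⟨hd, hac, hL, hL', -⟩, hne, heq⟩ := h
  obtain ⟨x₀, hx₀⟩ : ∃ x, ψ x ≠ 0 := Function.ne_iff.1 hne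
  -- multiplication by `conj (ψ x₀)` makes the real part nonzero at `x₀`
  let T : ℂ →L[ℝ] ℝ := Complex.reCLM ∘L
    ((ContinuousLinearMap.mul ℝ ℂ) ((starRingEnd ℂ) (ψ x₀)))
  have hT : ∀ (r : ℝ) (z : ℂ), T ((r : ℂ) * z) = r * T z := fun r z => by
    rw [← smul_eq_mul (a := r), ← map_smul]; simp
  have hderiv : deriv (fun x => T (ψ x)) = fun x => T (deriv ψ x) := by
    ext x
    exact (T.hasFDerivAt.comp_hasDerivAt x (hd x).hasDerivAt).deriv
  have hae : ∀ᵐ x, DifferentiableAt ℝ (deriv ψ) x := by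
    have : ∀ n : ℕ, ∀ᵐ x, x ∈ Set.uIcc (-n : ℝ) n → DifferentiableAt ℝ (deriv ψ) x :=
      fun n => by
        have hb := (hac (-n) n).boundedVariationOn
        exact hb.ae_differentiableAt_of_mem_uIcc
    rw [← ae_all_iff] at this
    filter_upwards [this] with x hx
    obtain ⟨n, hn⟩ := exists_nat_ge |x|
    refine hx n ?_
    rw [Set.uIcc_of_le (by linarith [abs_nonneg x])]
    exact abs_le.1 hn
  refine mismatch_eq_zero_of_isSolution (y := fun x => T (ψ x)) hq hab hk h0
    ⟨fun x => (T.differentiableAt.comp x (hd x)), fun c d => ?_, ?_⟩ ?_ ?_ ?_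
  · rw [hderiv]
    exact (hac c d).clm_comp T
  · filter_upwards [heq, hae] with x hx hdx
    have hdd : deriv (fun x => T (deriv ψ x)) x = T (deriv (deriv ψ) x) :=
      (T.hasFDerivAt.comp_hasDerivAt x hdx.hasDerivAt).deriv
    rw [hderiv, hdd, add_mul, ← hT, ← hT,
      Pi.zero_apply, ← map_neg, ← map_add, ← map_add]
    convert map_zero T
    push_cast at hx ⊢
    linear_combination hx
  · refine Function.ne_iff.2 ⟨x₀, ?_⟩
    simp only [T, ContinuousLinearMap.comp_apply, ContinuousLinearMap.mul_apply',
      Complex.reCLM_apply, ← Complex.normSq_eq_conj_mul_self, Complex.ofReal_re, Pi.zero_apply]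
    exact (Complex.normSq_pos.2 hx₀).ne'
  · exact T.comp_memLp' hL
  · rw [hderiv]
    exact T.comp_memLp' hL'

end Jost

/-! ### Eigenfunctions from the Jost solution -/

section Eigenfunction
variable {a b k : ℝ} {q : ℝ → ℝ}

/-- The function `1` on `[a, b]`, decaying like `exp (-k d)` at distance `d` from `[a, b]`. -/
noncomputable def tail (a b k x : ℝ) : ℝ := Real.exp (-k * |x - clamp a b x|)

lemma continuous_tail (a b k : ℝ) : Continuous (tail a b k) := by
  have := continuous_clamp a b
  unfold tail
  fun_prop

lemma clamp_of_le (hab : a ≤ b) {x : ℝ} (hx : x ≤ a) : clamp a b x = a := by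
  rw [clamp, min_eq_right (hx.trans hab), max_eq_left hx]

lemma clamp_of_ge (hab : a ≤ b) {x : ℝ} (hx : b ≤ x) : clamp a b x = b := by
  rw [clamp, min_eq_left hx, max_eq_right hab]

lemma tail_of_le (hab : a ≤ b) {x : ℝ} (hx : x ≤ a) : tail a b k x = Real.exp (k * (x - a)) := by
  rw [tail, clamp_of_le hab hx, abs_of_nonpos (by linarith)]
  congr 1
  ring

lemma tail_of_mem {x : ℝ} (hx : x ∈ Set.Icc a b) : tail a b k x = 1 := by
  simp [tail, clamp_of_mem hx]

lemma tail_of_ge (hab : a ≤ b) {x : ℝ} (hx : b ≤ x) :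
    tail a b k x = Real.exp (-k * (x - b)) := by
  rw [tail, clamp_of_ge hab hx, abs_of_nonneg (by linarith)]

lemma memLp_tail (hab : a ≤ b) (hk : 0 < k) : MemLp (tail a b k) 2 volume := by
  rw [memLp_two_iff_integrable_sq (continuous_tail a b k).aestronglyMeasurable,
    ← integrableOn_univ]
  have hU : (Set.univ : Set ℝ) = Set.Iic a ∪ Set.Icc a b ∪ Set.Ioi b := by
    ext x
    simp only [Set.mem_univ, Set.mem_union, Set.mem_Iic, Set.mem_Icc, Set.mem_Ioi, true_iff]
    by_contra! h
    exact absurd (h.1.2 h.1.1.le) (not_lt.2 h.2)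
  rw [hU]
  refine (IntegrableOn.union ?_ ?_).union ?_
  · have h1 : IntegrableOn (fun x => Real.exp (2 * k * x) * Real.exp (-(2 * k) * a)) (Set.Iic a) :=
      (integrableOn_exp_mul_Iic (by positivity) a).mul_const _
    refine h1.congr_fun (fun x hx => ?_) measurableSet_Iic
    simp only [tail_of_le hab hx, ← Real.exp_add, ← Real.exp_nat_mul]
    congr 1
    push_cast
    ring
  · exact ((continuous_tail a b k).pow 2).continuousOn.integrableOn_compact isCompact_Icc
  · have h1 : IntegrableOn (fun x => Real.exp (-(2 * k) * x) * Real.exp (2 * k * b)) (Set.Ioi b) :=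
      (integrableOn_exp_mul_Ioi (by linarith) b).mul_const _
    refine h1.congr_fun (fun x hx => ?_) measurableSet_Ioi
    simp only [tail_of_ge hab (le_of_lt hx), ← Real.exp_add, ← Real.exp_nat_mul]
    congr 1
    push_cast
    ring

lemma memLp_mul_tail (hab : a ≤ b) (hk : 0 < k) (f : ℝ →ᵇ ℝ) :
    MemLp (fun x => f x * tail a b k x) 2 volume := by
  refine ((memLp_tail hab hk).const_mul ‖f‖).mono
    (f.continuous.mul (continuous_tail a b k)).aestronglyMeasurable
    (Eventually.of_forall fun x => ?_)
  rw [norm_mul, norm_mul, norm_norm]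
  gcongr
  exact f.norm_coe_le_norm x

lemma integral_const_mul_exp (c s d e : ℝ) :
    ∫ t in d..e, c * s * Real.exp (s * (t - a)) =
      c * Real.exp (s * (e - a)) - c * Real.exp (s * (d - a)) := by
  rw [intervalIntegral.integral_eq_sub_of_hasDerivAt
    (f := fun t => c * Real.exp (s * (t - a))) (fun t _ => ?_)
    (Continuous.intervalIntegrable (by fun_prop) _ _)]
  refine (((((hasDerivAt_id' t).sub_const a).const_mul s).exp).const_mul c).congr_deriv ?_
  ring

/-- If the Jost solution matches the decaying exponential at `b`, then, continued by exponentials,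
it is an eigenfunction. -/
lemma eigenvalue_of_mismatch_eq_zero (hq : MemLp q ⊤ volume) (hab : a ≤ b) (hk : 0 < k)
    (h0 : ∀ᵐ x, x ∉ Set.Icc a b → q x = 0) (h : mismatch a b q k = 0) :
    IsSchrodingerEigenvalue q (-k ^ 2) := by
  have hWtop := memLp_top_add_const hq (k ^ 2)
  have hW := hWtop.locallyIntegrable le_top
  set F := jost a b q k with hF
  set F' := jostDeriv a b q k with hF'
  have hFx : ∀ x, F x = 1 + ∫ t in a..clamp a b x, F' t := fun x => by
    rw [hF, jost_eq hq hab]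
    simp [prim_apply locallyIntegrable_one, ← hF']
  have hF'x : ∀ x, F' x = k + ∫ t in a..clamp a b x, (q t + k ^ 2) * F t := fun x => by
    rw [hF', jostDeriv]
    simp [prim_apply hW, ← hF]
  have hF'b : F' b = -k * F b := by
    rw [mismatch, ← hF, ← hF'] at h
    linarith
  -- `F` and `F'` are constant outside `[a, b]`; as `F'(b) = -k F(b)`, the same decaying factor continues
  -- both of them
  let ψ : ℝ → ℝ := fun x => F x * tail a b k x
  let ψ' : ℝ → ℝ := fun x => F' x * tail a b k x
  have cψ : Continuous ψ := F.continuous.mul (continuous_tail a b k)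
  have cψ' : Continuous ψ' := F'.continuous.mul (continuous_tail a b k)
  have iW : ∀ c d, IntervalIntegrable (fun t => (q t + k ^ 2) * ψ t) volume c d := fun c d =>
    (hW.on_interval c d).mul_continuousOn cψ.continuousOn
  have hl : ∀ x ≤ a, ψ x = Real.exp (k * (x - a)) ∧ ψ' x = k * Real.exp (k * (x - a)) :=
    fun x hx => by
      simp only [ψ, ψ']
      rw [hFx, hF'x, clamp_of_le hab hx, tail_of_le hab hx]
      simp
  have hm : ∀ x ∈ Set.Icc a b, ψ x = F x ∧ ψ' x = F' x := fun x hx => by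
    simp only [ψ, ψ', tail_of_mem hx, mul_one, and_self]
  have hr : ∀ x, b ≤ x → ψ x = F b * Real.exp (-k * (x - b)) ∧
      ψ' x = -k * F b * Real.exp (-k * (x - b)) := fun x hx => by
    simp only [ψ, ψ']
    rw [← hF'b, tail_of_ge hab hx, hFx x, hF'x x, clamp_of_ge hab hx, hFx b, hF'x b,
      clamp_right hab]
    exact ⟨rfl, rfl⟩
  have ha : a ∈ Set.Icc a b := ⟨le_rfl, hab⟩
  have hb : b ∈ Set.Icc a b := ⟨hab, le_rfl⟩
  -- the integral form of the equation on the three parts of the line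
  have Il : ∀ x ≤ a, (∫ t in a..x, ψ' t = ψ x - ψ a) ∧
      ∫ t in a..x, (q t + k ^ 2) * ψ t = ψ' x - ψ' a := fun x hx => by
    constructor
    · rw [(hl x hx).1, (hl a le_rfl).1]
      have := integral_const_mul_exp (a := a) 1 k a x
      simp only [one_mul] at this
      rw [← this]
      refine intervalIntegral.integral_congr fun t ht => ?_
      rw [Set.uIcc_of_ge hx] at ht
      exact (hl t ht.2).2
    · rw [(hl x hx).2, (hl a le_rfl).2, ← integral_const_mul_exp (a := a) k k a x]
      refine intervalIntegral.integral_congr_ae ?_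
      filter_upwards [h0, Measure.ae_ne volume a] with t ht hta hmem
      rw [Set.uIoc_of_ge hx] at hmem
      rw [(hl t hmem.2).1, ht fun hm => absurd (lt_of_le_of_ne hmem.2 hta) (not_lt.2 hm.1)]
      ring
  have Im : ∀ x ∈ Set.Icc a b, (∫ t in a..x, ψ' t = ψ x - ψ a) ∧
      ∫ t in a..x, (q t + k ^ 2) * ψ t = ψ' x - ψ' a := fun x hx => by
    have hsub : ∀ t ∈ Set.uIcc a x, t ∈ Set.Icc a b := fun t ht => by
      rw [Set.uIcc_of_le hx.1] at ht
      exact ⟨ht.1, ht.2.trans hx.2⟩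
    constructor
    · rw [(hm x hx).1, (hl a le_rfl).1, hFx, clamp_of_mem hx]
      simp only [sub_self, mul_zero, Real.exp_zero, add_sub_cancel_left]
      exact intervalIntegral.integral_congr fun t ht => (hm t (hsub t ht)).2
    · rw [(hm x hx).2, (hl a le_rfl).2, hF'x, clamp_of_mem hx]
      simp only [sub_self, mul_zero, Real.exp_zero, mul_one, add_sub_cancel_left]
      exact intervalIntegral.integral_congr fun t ht => by simp only [(hm t (hsub t ht)).1]
  have Ir : ∀ x, b ≤ x → (∫ t in b..x, ψ' t = ψ x - ψ b) ∧
      ∫ t in b..x, (q t + k ^ 2) * ψ t = ψ' x - ψ' b := fun x hx => by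
    constructor
    · rw [(hr x hx).1, (hr b le_rfl).1, ← integral_const_mul_exp (a := b) (F b) (-k) b x]
      refine intervalIntegral.integral_congr fun t ht => ?_
      rw [Set.uIcc_of_le hx] at ht
      simp only [(hr t ht.1).2]
      ring
    · rw [(hr x hx).2, (hr b le_rfl).2, ← integral_const_mul_exp (a := b) (-k * F b) (-k) b x]
      refine intervalIntegral.integral_congr_ae ?_
      filter_upwards [h0] with t ht hmem
      rw [Set.uIoc_of_le hx] at hmem
      rw [(hr t hmem.1.le).1, ht fun hm => absurd hmem.1 (not_lt.2 hm.2)]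
      ring
  have I : ∀ x, (∫ t in a..x, ψ' t = ψ x - ψ a) ∧
      ∫ t in a..x, (q t + k ^ 2) * ψ t = ψ' x - ψ' a := fun x => by
    rcases le_total x a with hx | hx
    · exact Il x hx
    rcases le_total b x with hx' | hx'
    · rw [← intervalIntegral.integral_add_adjacent_intervals (b := b)
        (cψ'.intervalIntegrable _ _) (cψ'.intervalIntegrable _ _),
        ← intervalIntegral.integral_add_adjacent_intervals (b := b) (iW _ _) (iW _ _),
        (Im b hb).1, (Im b hb).2, (Ir x hx').1, (Ir x hx').2]
      constructor <;> ring
    · exact Im x ⟨hx, hx'⟩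
  have dψ : ∀ x, HasDerivAt ψ (ψ' x) x := fun x => by
    have h1 : ψ = fun x => ψ a + ∫ t in a..x, ψ' t := by
      ext x; rw [(I x).1]; ring
    rw [h1]
    exact (intervalIntegral.integral_hasDerivAt_right (cψ'.intervalIntegrable _ _)
      (cψ'.stronglyMeasurableAtFilter _ _) cψ'.continuousAt).const_add _
  have eψ' : ψ' = fun x => ψ' a + ∫ t in a..x, (q t + k ^ 2) * ψ t := by
    ext x; rw [(I x).2]; ring
  have aψ' : ∀ c d, AbsolutelyContinuousOnInterval ψ' c d := fun c d => by
    have h1 : AbsolutelyContinuousOnInterval ψ' (min a (min c d)) (max a (max c d)) := by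
      rw [eψ']
      refine AbsolutelyContinuousOnInterval.fun_add
        ((LipschitzWith.const (ψ' a)).lipschitzOnWith.absolutelyContinuousOnInterval)
        ((iW _ _).absolutelyContinuousOnInterval_intervalIntegral ?_)
      rw [Set.uIcc_of_le (min_le_of_left_le (le_max_left _ _))]
      exact ⟨min_le_left _ _, le_max_left _ _⟩
    refine h1.mono ?_
    rw [Set.uIcc_of_le (min_le_of_left_le (le_max_left a (max c d))), Set.uIcc]
    exact Set.Icc_subset_Icc (min_le_right _ _) (le_max_right _ _)
  have dψ' : ∀ᵐ x, HasDerivAt ψ' ((q x + k ^ 2) * ψ x) x := by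
    have hall : ∀ n : ℕ, ∀ᵐ x, x ∈ Set.uIcc (a - n) (a + n) →
        HasDerivAt ψ' ((q x + k ^ 2) * ψ x) x := fun n => by
      filter_upwards [(iW (a - n) (a + n)).ae_hasDerivAt_integral] with x hx hmem
      rw [eψ']
      have hn : (0 : ℝ) ≤ n := n.cast_nonneg
      refine (hx hmem a ?_).const_add _
      rw [Set.uIcc_of_le (by linarith)]
      constructor <;> linarith
    rw [← ae_all_iff] at hall
    filter_upwards [hall] with x hx
    obtain ⟨n, hn⟩ := exists_nat_ge |x - a|
    refine hx n ?_
    rw [Set.uIcc_of_le (by linarith [abs_nonneg (x - a)])]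
    have := abs_le.1 hn
    constructor <;> linarith
  have dC : deriv (fun x => (ψ x : ℂ)) = fun x => (ψ' x : ℂ) :=
    funext fun x => (dψ x).ofReal_comp.deriv
  have ddC : ∀ᵐ x, deriv (deriv (fun x => (ψ x : ℂ))) x = ((q x + k ^ 2) * ψ x : ℝ) := by
    rw [dC]
    exact dψ'.mono fun x hx => hx.ofReal_comp.deriv
  have Lψ : MemLp ψ 2 volume := memLp_mul_tail hab hk F
  refine ⟨fun x => (ψ x : ℂ), ⟨fun x => (dψ x).ofReal_comp.differentiableAt, fun c d => ?_,
    Lψ.ofReal, ?_, ?_⟩, ?_, ?_⟩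
  · rw [dC]
    exact (aψ' c d).clm_comp Complex.ofRealCLM
  · rw [dC]
    exact (memLp_mul_tail hab hk F').ofReal
  · have h2 : MemLp (fun x => (q x + k ^ 2) * ψ x) 2 volume := Lψ.mul hWtop
    exact (memLp_congr_ae ddC).2 h2.ofReal
  · refine Function.ne_iff.2 ⟨a, ?_⟩
    simp [(hl a le_rfl).1]
  · filter_upwards [ddC] with x hx
    rw [hx]
    push_cast
    ring

end Eigenfunction

/-! ### Wronskians and the size of the perturbation -/

section Threshold
variable {a b : ℝ}

lemma exists_support_interval {U V V₁ : ℝ → ℝ} {Vl : ℝ → ℝ → ℝ}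
    (hU : IsBoundedCompactlySupported U) (hV : IsBoundedCompactlySupported V)
    (hV₁ : IsBoundedCompactlySupported V₁)
    (hVl : ∃ R : ℝ, ∀ᶠ lam : ℝ in 𝓝[>] 0, ∀ᵐ x : ℝ, R < |x| → Vl lam x = 0) :
    ∃ R : ℝ, 0 < R ∧ (∀ᵐ x, x ∉ Set.Icc (-R) R → U x = 0) ∧
      (∀ᵐ x, x ∉ Set.Icc (-R) R → V x = 0) ∧ (∀ᵐ x, x ∉ Set.Icc (-R) R → V₁ x = 0) ∧
      ∀ᶠ lam : ℝ in 𝓝[>] 0, ∀ᵐ x, x ∉ Set.Icc (-R) R → Vl lam x = 0 := by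
  obtain ⟨-, R₁, h₁⟩ := hU
  obtain ⟨-, R₂, h₂⟩ := hV
  obtain ⟨-, R₃, h₃⟩ := hV₁
  obtain ⟨R₄, h₄⟩ := hVl
  have hlt : ∀ {r R x : ℝ}, r ≤ R → x ∉ Set.Icc (-R) R → r < |x| := fun hr hx => by
    refine hr.trans_lt ?_
    by_contra! hc
    exact hx (abs_le.1 hc)
  refine ⟨max 1 (max (max R₁ R₂) (max R₃ R₄)), by positivity, ?_, ?_, ?_, ?_⟩
  · exact h₁.mono fun x hx hm => hx (hlt (by simp) hm)
  · exact h₂.mono fun x hx hm => hx (hlt (by simp) hm)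
  · exact h₃.mono fun x hx hm => hx (hlt (by simp) hm)
  · exact h₄.mono fun lam h => h.mono fun x hx hm => hx (hlt (by simp) hm)

lemma prim_apply_eq_integral {q f : ℝ → ℝ} {y : ℝ →ᵇ ℝ} (hab : a ≤ b)
    (hq : LocallyIntegrable q volume) (h0 : ∀ᵐ x, x ∉ Set.Icc a b → q x = 0)
    (hy : ∀ x ∈ Set.Icc a b, y x = f x) : prim a b q y b = ∫ x, q x * f x := by
  have h1 : ∫ x in Set.Icc a b, q x * f x = ∫ x, q x * f x :=
    setIntegral_eq_integral_of_ae_compl_eq_zero (h0.mono fun x hx hm => by rw [hx hm, zero_mul])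
  rw [prim_apply hq, clamp_right hab, intervalIntegral.integral_of_le hab,
    ← integral_Icc_eq_integral_Ioc, ← h1]
  exact setIntegral_congr_fun measurableSet_Icc fun x hx => by simp only [hy x hx]

lemma integrable_mul_of_support {q f : ℝ → ℝ} (hq : LocallyIntegrable q volume)
    (h0 : ∀ᵐ x, x ∉ Set.Icc a b → q x = 0) (hf : Continuous f) :
    Integrable (fun x => q x * f x) volume := by
  have h1 : IntegrableOn (fun x => q x * f x) (Set.Icc a b) :=
    (hq.integrableOn_isCompact isCompact_Icc).mul_continuousOn hf.continuousOn isCompact_Icc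
  refine (integrable_indicator_iff measurableSet_Icc).2 h1 |>.congr ?_
  filter_upwards [h0] with x hx
  by_cases hm : x ∈ Set.Icc a b
  · rw [Set.indicator_of_mem hm]
  · rw [Set.indicator_of_notMem hm, hx hm, zero_mul]

/-- Convergence of the potentials in `L²` controls the operators `prim`, which only see the
`L¹` norm on `[a, b]`. -/
lemma norm_prim_le_eLpNorm_two {q : ℝ → ℝ} (hq : MemLp q 2 volume) (a b : ℝ) :
    ‖prim a b q‖ ≤ (eLpNorm q 2 volume).toReal *
      (volume (Set.Ioc a b) ^ (1 / (1 : ℝ) - 1 / 2)).toReal := by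
  refine (norm_prim_le a b q).trans ?_
  have hm : AEStronglyMeasurable q (volume.restrict (Set.Ioc a b)) :=
    hq.1.restrict
  have h1 := eLpNorm_le_eLpNorm_mul_rpow_measure_univ (p := 1) (q := 2) (by norm_num) hm
  have h2 : eLpNorm q 2 (volume.restrict (Set.Ioc a b)) ≤ eLpNorm q 2 volume :=
    eLpNorm_restrict_le _ _ _ _
  rw [Measure.restrict_apply_univ] at h1
  have h3 : ∫ t in Set.Ioc a b, |q t| =
      (eLpNorm q 1 (volume.restrict (Set.Ioc a b))).toReal := by
    rw [eLpNorm_one_eq_lintegral_enorm]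
    exact integral_norm_eq_lintegral_enorm hm
  have hfin : volume (Set.Ioc a b) ^ (1 / (1 : ℝ) - 1 / 2) ≠ ⊤ :=
    ENNReal.rpow_ne_top_of_nonneg (by norm_num) (by simp)
  rw [h3, ← ENNReal.toReal_mul]
  refine ENNReal.toReal_mono (ENNReal.mul_ne_top hq.2.ne hfin) (h1.trans ?_)
  simp only [ENNReal.toReal_one, ENNReal.toReal_ofNat]
  gcongr

lemma memLp_two_of_support {q : ℝ → ℝ} (hq : MemLp q ⊤ volume)
    (h0 : ∀ᵐ x, x ∉ Set.Icc a b → q x = 0) : MemLp q 2 volume := by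
  have h1 : MemLp q 2 (volume.restrict (Set.Icc a b)) := by
    have : IsFiniteMeasure (volume.restrict (Set.Icc a b)) := ⟨by simp⟩
    exact (hq.restrict _).mono_exponent le_top
  refine ((memLp_indicator_iff_restrict measurableSet_Icc).2 h1).ae_eq ?_
  filter_upwards [h0] with x hx
  by_cases hm : x ∈ Set.Icc a b
  · rw [Set.indicator_of_mem hm]
  · rw [Set.indicator_of_notMem hm, hx hm]

/-- The Wronskian identity for the Jost solution of a perturbed potential `U + p` and a solution
`u` of the unperturbed equation. -/
lemma jostDeriv_mul_sub {U p q : ℝ → ℝ} {k : ℝ} (hab : a ≤ b) (hU : LocallyIntegrable U volume)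
    (hp : LocallyIntegrable p volume) (hq : MemLp q ⊤ volume)
    (hpq : ∀ x, q x + k ^ 2 = U x + p x) {u u' : ℝ →ᵇ ℝ} {α β : ℝ}
    (hu : u = α • 1 + prim a b (fun _ => 1) u') (hu' : u' = β • 1 + prim a b U u) (x : ℝ) :
    jostDeriv a b q k x * u x - jost a b q k x * u' x =
      k * α - β + prim a b p (jost a b q k * u) x := by
  have e : (fun x => q x + k ^ 2) = fun x => U x + p x := funext hpq
  have hUp : LocallyIntegrable (fun x => U x + p x) volume := hU.add hp
  have hF' : jostDeriv a b q k = k • 1 + prim a b (fun x => U x + p x) (jost a b q k) := by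
    rw [jostDeriv, e]
  have hF : jost a b q k = (1 : ℝ) • 1 + prim a b (fun _ => 1) (jostDeriv a b q k) := by
    rw [one_smul]; exact jost_eq hq hab
  have h1 := mul_eq_add_prim hUp locallyIntegrable_one hab hF' hu
  have h2 := mul_eq_add_prim locallyIntegrable_one hU hab hF hu'
  rw [prim_add hU hp] at h1
  have h1x := DFunLike.congr_fun h1 x
  have h2x := DFunLike.congr_fun h2 x
  simp only [BoundedContinuousFunction.coe_mul, BoundedContinuousFunction.coe_add, Pi.mul_apply,
    Pi.add_apply, BoundedContinuousFunction.coe_smul, smul_eq_mul, add_apply,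
    BoundedContinuousFunction.coe_one, Pi.one_apply, mul_one, one_mul] at h1x h2x
  rw [h1x, h2x]
  ring

/-- The Wronskian with the solution `z` of `-z'' + U z = 0`, `z(a) = 0`, `z'(a) = 1` shows that a
half-bound state does not vanish at `b`. -/
lemma halfBound_ne_zero {U : ℝ → ℝ} (hab : a ≤ b) (hU : MemLp U ⊤ volume) {u u' : ℝ →ᵇ ℝ}
    (hu : u = 1 + prim a b (fun _ => 1) u') (hu' : u' = prim a b U u) (hb : u' b = 0) :
    u b ≠ 0 := by
  intro hub
  have hl := hU.locallyIntegrable le_top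
  have hun := isUnit_one_sub_volterra hU hab
  set z := Ring.inverse (1 - volterra a b U) (prim a b (fun _ => 1) 1) with hz
  have h1 : z = (0 : ℝ) • 1 + prim a b (fun _ => 1) ((1 : ℝ) • 1 + prim a b U z) := by
    have := apply_inverse_apply hun (prim a b (fun _ => 1) 1)
    rw [← hz, sub_apply, sub_eq_iff_eq_add] at this
    rw [zero_smul, zero_add, one_smul, map_add]
    exact this
  have e1 := mul_eq_add_prim hl locallyIntegrable_one (y := (1 : ℝ) • 1 + prim a b U z) (z := u)
    (α := 1) (β := 1) hab rfl
    (by rw [one_smul, hu])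
  have e2 := mul_eq_add_prim locallyIntegrable_one hl (y := z) (z := u') (β := 0) hab h1
    (by rw [zero_smul, zero_add]; exact hu')
  have e1b := DFunLike.congr_fun e1 b
  have e2b := DFunLike.congr_fun e2 b
  simp only [BoundedContinuousFunction.coe_mul, BoundedContinuousFunction.coe_add, Pi.mul_apply,
    Pi.add_apply, BoundedContinuousFunction.coe_smul, smul_eq_mul, hub, hb, mul_zero,
    BoundedContinuousFunction.coe_one, Pi.one_apply, mul_one] at e1b e2b
  linarith

end Threshold

/-! ### Roots of the matching condition and the expansion of the eigenvalue -/

section Roots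
variable {m : ℝ → ℝ → ℝ} {I c : ℝ}

/-- Every small positive root of an equation `c k + lam² I + o(k + lam²) = 0` is asymptotically
`-(I / c) lam²`. -/
lemma root_isLittleO (hc : 0 < c)
    (hm : (fun z : ℝ × ℝ => m z.1 z.2 - (z.2 * c + z.1 ^ 2 * I))
      =o[smallParams] (fun z => z.2 + z.1 ^ 2)) {κ : ℝ → ℝ}
    (hκ : Tendsto κ (𝓝[>] 0) (𝓝[>] 0)) (h0 : ∀ᶠ lam in 𝓝[>] 0, m lam (κ lam) = 0) :
    (fun lam => κ lam - -I / c * lam ^ 2) =o[𝓝[>] 0] (fun lam => lam ^ 2) := by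
  have ht : Tendsto (fun lam : ℝ => (lam, κ lam)) (𝓝[>] 0) smallParams := tendsto_id.prodMk hκ
  have h1 : (fun lam => -(κ lam * c + lam ^ 2 * I)) =o[𝓝[>] 0] (fun lam => κ lam + lam ^ 2) :=
    (hm.comp_tendsto ht).congr' (h0.mono fun lam h => by simp [h]) EventuallyEq.rfl
  have hpos : ∀ᶠ lam in 𝓝[>] (0 : ℝ), 0 < κ lam := hκ.eventually self_mem_nhdsWithin
  have h2 : κ =O[𝓝[>] 0] (fun lam => lam ^ 2) := by
    refine IsBigO.of_bound (1 + 2 * |I| / c) ?_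
    filter_upwards [h1.def (c := c / 2) (by positivity), hpos] with lam hb hk
    rw [norm_neg, Real.norm_eq_abs, Real.norm_of_nonneg (by positivity)] at hb
    rw [Real.norm_of_nonneg hk.le, Real.norm_of_nonneg (sq_nonneg lam)]
    have h3 := (abs_le.1 hb).2
    have h4 : -|I| ≤ I := neg_abs_le I
    have h5 : κ lam * c ≤ (c + 2 * |I|) * lam ^ 2 := by nlinarith [sq_nonneg lam]
    have h6 : (1 + 2 * |I| / c) * lam ^ 2 = (c + 2 * |I|) * lam ^ 2 / c := by field_simp
    rw [h6, le_div_iff₀ hc]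
    exact h5
  have h3 : (fun lam => -(κ lam * c + lam ^ 2 * I)) =o[𝓝[>] 0] (fun lam => lam ^ 2) :=
    h1.trans_isBigO (h2.add (isBigO_refl _ _))
  refine (h3.const_mul_left (-1 / c)).congr_left fun lam => ?_
  field_simp
  ring

/-- If `I < 0`, the equation `c k + lam² I + o(k + lam²) = 0` has a positive root `k` for every small
`lam`, trapped between two parabolas in `lam`. -/
lemma exists_root (hc : 0 < c) (hI : I < 0)
    (hcont : ∀ᶠ lam in 𝓝[>] 0, Continuous (m lam))
    (hm : (fun z : ℝ × ℝ => m z.1 z.2 - (z.2 * c + z.1 ^ 2 * I))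
      =o[smallParams] (fun z => z.2 + z.1 ^ 2)) :
    ∃ κ : ℝ → ℝ, Tendsto κ (𝓝[>] 0) (𝓝[>] 0) ∧ ∀ᶠ lam in 𝓝[>] 0, m lam (κ lam) = 0 := by
  have hpos : ∀ᶠ lam in 𝓝[>] (0 : ℝ), 0 < lam := self_mem_nhdsWithin
  have hsq : ∀ t : ℝ, Tendsto (fun lam : ℝ => t * lam ^ 2) (𝓝[>] 0) (𝓝 0) := fun t => by
    have : Tendsto (fun lam : ℝ => t * lam ^ 2) (𝓝 0) (𝓝 (t * 0 ^ 2)) :=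
      Continuous.tendsto (by fun_prop) 0
    simp only [ne_eq, OfNat.ofNat_ne_zero, not_false_eq_true, zero_pow, mul_zero] at this
    exact this.mono_left nhdsWithin_le_nhds
  -- the sign of `m` on a parabola `k = t lam²` is that of `t c + I`
  have key : ∀ t : ℝ, 0 < t → ∀ᶠ lam in 𝓝[>] 0,
      |m lam (t * lam ^ 2) - lam ^ 2 * (t * c + I)| ≤ lam ^ 2 * (-I / 2) := by
    intro t ht
    have hz : Tendsto (fun lam : ℝ => (lam, t * lam ^ 2)) (𝓝[>] 0) smallParams :=
      tendsto_id.prodMk (tendsto_nhdsWithin_iff.2 ⟨hsq t, hpos.mono fun lam h =>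
        show 0 < t * lam ^ 2 by positivity⟩)
    have hb := (hm.comp_tendsto hz).def (c := -I / 2 / (t + 1)) (by
      have : 0 < -I := by linarith
      positivity)
    filter_upwards [hb] with lam h
    simp only [Function.comp_apply, Real.norm_eq_abs] at h
    rw [abs_of_nonneg (a := t * lam ^ 2 + lam ^ 2) (by positivity)] at h
    have e1 : t * lam ^ 2 * c + lam ^ 2 * I = lam ^ 2 * (t * c + I) := by ring
    have e2 : -I / 2 / (t + 1) * (t * lam ^ 2 + lam ^ 2) = lam ^ 2 * (-I / 2) := by field_simp
    rwa [e1, e2] at h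
  have hI' : 0 < -I := by linarith
  have ht₁ : 0 < -I / (2 * c) := by positivity
  have ht₂ : 0 < -2 * I / c := by
    have : 0 < -2 * I := by linarith
    positivity
  have hex : ∀ᶠ lam in 𝓝[>] 0, ∃ k, k ∈ Set.Icc (-I / (2 * c) * lam ^ 2) (-2 * I / c * lam ^ 2) ∧
      m lam k = 0 := by
    filter_upwards [key _ ht₁, key _ ht₂, hcont, hpos] with lam h1 h2 h3 h4
    have e1 : -I / (2 * c) * c + I = I / 2 := by field_simp; ring
    have e2 : -2 * I / c * c + I = -I := by field_simp; ring
    rw [e1] at h1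
    rw [e2] at h2
    have hl2 : 0 < lam ^ 2 := by positivity
    have g1 : m lam (-I / (2 * c) * lam ^ 2) ≤ 0 := by nlinarith [(abs_le.1 h1).2]
    have g2 : 0 ≤ m lam (-2 * I / c * lam ^ 2) := by nlinarith [(abs_le.1 h2).1]
    have hle : -I / (2 * c) * lam ^ 2 ≤ -2 * I / c * lam ^ 2 := by
      refine mul_le_mul_of_nonneg_right ?_ hl2.le
      rw [div_le_div_iff₀ (by positivity) hc]
      nlinarith
    exact intermediate_value_Icc hle h3.continuousOn ⟨g1, g2⟩
  obtain ⟨κ, hκ⟩ := hex.choice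
  refine ⟨κ, tendsto_nhdsWithin_iff.2 ⟨?_, ?_⟩, hκ.mono fun lam h => h.2⟩
  · exact tendsto_of_tendsto_of_tendsto_of_le_of_le' (hsq _) (hsq _)
      (hκ.mono fun lam h => h.1.1) (hκ.mono fun lam h => h.1.2)
  · filter_upwards [hκ, hpos] with lam h hl
    exact lt_of_lt_of_le (by positivity) h.1.1

lemma sq_sub_sq_isLittleO {κ : ℝ → ℝ} {d : ℝ}
    (h : (fun lam => κ lam - d * lam ^ 2) =o[𝓝[>] 0] (fun lam => lam ^ 2)) :
    (fun lam => κ lam ^ 2 - d ^ 2 * lam ^ 4) =o[𝓝[>] 0] (fun lam => lam ^ 4) := by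
  have h1 : (fun lam : ℝ => 2 * d * lam ^ 2) =O[𝓝[>] 0] (fun lam => lam ^ 2) :=
    (isBigO_refl _ _).const_mul_left _
  have h2 := h.mul_isBigO (h.isBigO.add h1)
  refine h2.congr (fun lam => ?_) (fun lam => ?_) <;> ring

end Roots

section Asymptotic
variable {a b θ : ℝ} {U V V₁ u v : ℝ → ℝ} {Vl : ℝ → ℝ → ℝ}

lemma affine_tendsto_atBot {y : ℝ → ℝ} {d L : ℝ} (h : ∀ x ≤ a, y x = y a + d * (x - a))
    (hL : Tendsto y atBot (𝓝 L)) : d = 0 ∧ y a = L := by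
  have hd : Tendsto (fun x => y x - y (x - 1)) atBot (𝓝 (L - L)) :=
    hL.sub (hL.comp (tendsto_atBot_add_const_right _ (-1 : ℝ) tendsto_id))
  have h0 : d = L - L := by
    refine tendsto_nhds_unique (tendsto_const_nhds.congr' ?_) hd
    filter_upwards [eventually_le_atBot a] with x hx
    rw [h x hx, h (x - 1) (by linarith)]
    ring
  rw [sub_self] at h0
  refine ⟨h0, tendsto_nhds_unique (tendsto_const_nhds.congr' ?_) hL⟩
  filter_upwards [eventually_le_atBot a] with x hx
  rw [h x hx, h0, zero_mul, add_zero]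

lemma affine_tendsto_atTop {y : ℝ → ℝ} {d L : ℝ} (h : ∀ x ≥ b, y x = y b + d * (x - b))
    (hL : Tendsto y atTop (𝓝 L)) : d = 0 ∧ y b = L := by
  have h' := affine_tendsto_atBot (y := fun x => y (-x)) (a := -b) (d := -d) (L := L)
    (fun x hx => by
      have hx' : b ≤ -x := by linarith
      simp only [neg_neg, h (-x) hx']
      ring)
    (hL.comp tendsto_neg_atBot_atTop)
  simpa using h'

lemma ae_uIoc_zero_left {q : ℝ → ℝ} (h0 : ∀ᵐ x, x ∉ Set.Icc a b → q x = 0) {x : ℝ} (hx : x ≤ a) :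
    ∀ᵐ t, t ∈ Set.uIoc a x → q t = 0 := by
  filter_upwards [h0, Measure.ae_ne volume a] with t ht hta hmem
  rw [Set.uIoc_of_ge hx] at hmem
  exact ht fun hm => absurd (lt_of_le_of_ne hmem.2 hta) (not_lt.2 hm.1)

lemma ae_uIoc_zero_right {q : ℝ → ℝ} (h0 : ∀ᵐ x, x ∉ Set.Icc a b → q x = 0) {x : ℝ} (hx : b ≤ x) :
    ∀ᵐ t, t ∈ Set.uIoc b x → q t = 0 := by
  filter_upwards [h0] with t ht hmem
  rw [Set.uIoc_of_le hx] at hmem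
  exact ht fun hm => absurd hmem.1 (not_lt.2 hm.2)

/-- On `[a, b]` a normalized half-bound state has the boundary values `u(a) = 1`, `u(b) = θ` and
`u'(a) = u'(b) = 0`. -/
lemma exists_halfBound_clamped (hab : a ≤ b) (hU : MemLp U ⊤ volume)
    (hU0 : ∀ᵐ x, x ∉ Set.Icc a b → U x = 0) (hu : IsNormalizedHalfBoundState U u θ) :
    ∃ Y Y' : ℝ →ᵇ ℝ, (∀ x ∈ Set.Icc a b, Y x = u x) ∧
      Y = 1 + prim a b (fun _ => 1) Y' ∧ Y' = prim a b U Y ∧ Y b = θ ∧ Y' b = 0 := by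
  obtain ⟨⟨hs, -, -⟩, hbot, htop⟩ := hu
  obtain ⟨h1, h2⟩ := affine_tendsto_atBot (a := a) (fun x hx => hs.affine
    ((ae_uIoc_zero_left hU0 hx).mono fun t ht hm => ⟨ht hm, rfl⟩)) hbot
  obtain ⟨h3, h4⟩ := affine_tendsto_atTop (b := b) (fun x hx => hs.affine
    ((ae_uIoc_zero_right hU0 hx).mono fun t ht hm => ⟨ht hm, rfl⟩)) htop
  obtain ⟨Y, Y', hY, hY', e1, e2⟩ := hs.exists_clamped_zero hab (hU.locallyIntegrable le_top)
  rw [h2, one_smul] at e1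
  rw [h1, zero_smul, zero_add] at e2
  refine ⟨Y, Y', fun x hx => by rw [hY, clamp_of_mem hx], e1, e2, ?_, ?_⟩
  · rw [hY, clamp_right hab, h4]
  · rw [hY', clamp_right hab, h3]

/-- On `[a, b]` the solution `v` has zero Cauchy data at `a`, so it solves `v = J U v + J V u` with `J`
integration from `a`. -/
lemma exists_vStar_clamped (hab : a ≤ b) (hU : MemLp U ⊤ volume) (hV : MemLp V ⊤ volume)
    (hU0 : ∀ᵐ x, x ∉ Set.Icc a b → U x = 0) (hV0 : ∀ᵐ x, x ∉ Set.Icc a b → V x = 0)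
    (hv : IsVStar U V u v) {Y : ℝ →ᵇ ℝ} (hY : ∀ x ∈ Set.Icc a b, Y x = u x) :
    ∃ Z : ℝ →ᵇ ℝ, (∀ x ∈ Set.Icc a b, Z x = v x) ∧
      Z = prim a b (fun _ => 1) (prim a b U Z) + prim a b (fun _ => 1) (prim a b V Y) := by
  obtain ⟨hs, hbot⟩ := hv
  have hlU := hU.locallyIntegrable le_top
  have hlV := hV.locallyIntegrable le_top
  obtain ⟨h1, h2⟩ := affine_tendsto_atBot (a := a) (L := 0) (fun x hx => hs.affine (by
    filter_upwards [ae_uIoc_zero_left hU0 hx, ae_uIoc_zero_left hV0 hx] with t ht ht' hm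
    exact ⟨ht hm, by rw [ht' hm]; simp⟩)) (tendsto_const_nhds.congr' (hbot.mono fun x h => h.symm))
  obtain ⟨Z, Z', hZ, -, e1, e2⟩ := hs.exists_clamped hab
  refine ⟨Z, fun x hx => by rw [hZ, clamp_of_mem hx], ?_⟩
  have e3 : Z' = prim a b U Z + prim a b V Y := by
    ext x
    rw [e2, h1, zero_add, BoundedContinuousFunction.coe_add, Pi.add_apply, prim_apply hlU,
      prim_apply hlV, ← intervalIntegral.integral_add (hlU.mul_bcf Z _ _) (hlV.mul_bcf Y _ _)]
    refine intervalIntegral.integral_congr fun t ht => ?_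
    rw [Set.uIcc_of_le (le_clamp a b x)] at ht
    simp only [sub_neg_eq_add, hY t ⟨ht.1, ht.2.trans (clamp_le hab x)⟩]
  rw [h2, zero_smul, zero_add, e3, map_add] at e1
  exact e1

lemma prim_sub_isLittleO (hV : MemLp V ⊤ volume) (hV₁ : MemLp V₁ ⊤ volume)
    (hV0 : ∀ᵐ x, x ∉ Set.Icc a b → V x = 0) (hV₁0 : ∀ᵐ x, x ∉ Set.Icc a b → V₁ x = 0)
    (hVl : ∀ᶠ lam : ℝ in 𝓝[>] 0, MemLp (Vl lam) ⊤ volume)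
    (hVl0 : ∀ᶠ lam : ℝ in 𝓝[>] 0, ∀ᵐ x, x ∉ Set.Icc a b → Vl lam x = 0)
    (hlim : (fun lam : ℝ => (eLpNorm (fun x => Vl lam x - V x - lam * V₁ x) 2 volume).toReal)
      =o[𝓝[>] 0] (fun lam : ℝ => lam)) :
    (fun lam => prim a b (fun x => Vl lam x - V x - lam * V₁ x))
      =o[𝓝[>] 0] (fun lam : ℝ => lam) := by
  refine IsBigO.trans_isLittleO (IsBigO.of_bound
    (volume (Set.Ioc a b) ^ (1 / (1 : ℝ) - 1 / 2)).toReal ?_) hlim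
  filter_upwards [hVl, hVl0] with lam h1 h2
  have h3 : MemLp (fun x => Vl lam x - V x - lam * V₁ x) ⊤ volume :=
    (h1.sub hV).sub (hV₁.const_mul lam)
  refine (norm_prim_le_eLpNorm_two (memLp_two_of_support h3 (a := a) (b := b) ?_) a b).trans ?_
  · filter_upwards [h2, hV0, hV₁0] with x e1 e2 e3 hm
    rw [e1 hm, e2 hm, e3 hm]
    ring
  · rw [Real.norm_of_nonneg ENNReal.toReal_nonneg, mul_comm]

/-- Expansion of the mismatch for the operators `-d²/dx² + U + lam Vl`. -/
lemma mismatch_isLittleO (hab : a ≤ b) (hU : MemLp U ⊤ volume) (hV : MemLp V ⊤ volume)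
    (hV₁ : MemLp V₁ ⊤ volume) (hVl : ∀ᶠ lam : ℝ in 𝓝[>] 0, MemLp (Vl lam) ⊤ volume)
    (hE : (fun lam => prim a b (fun x => Vl lam x - V x - lam * V₁ x))
      =o[𝓝[>] 0] (fun lam : ℝ => lam))
    {Y Y' Z : ℝ →ᵇ ℝ} (hY : Y = 1 + prim a b (fun _ => 1) Y') (hY' : Y' = prim a b U Y)
    (hYb : Y b = θ) (hYb' : Y' b = 0)
    (hZ : Z = prim a b (fun _ => 1) (prim a b U Z) + prim a b (fun _ => 1) (prim a b V Y))
    (hzero : prim a b V (Y * Y) b = 0) :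
    (fun z : ℝ × ℝ => θ * mismatch a b (fun x => U x + z.1 * Vl z.1 x) z.2 -
      (z.2 * (1 + θ ^ 2) + z.1 ^ 2 * (prim a b V (Z * Y) b + prim a b V₁ (Y * Y) b)))
      =o[smallParams] (fun z => z.2 + z.1 ^ 2) := by
  have hlU := hU.locallyIntegrable le_top
  have hlV := hV.locallyIntegrable le_top
  have hlV₁ := hV₁.locallyIntegrable le_top
  have hun := isUnit_one_sub_volterra hU hab
  have hVl' := tendsto_fst_smallParams.eventually hVl
  have hp : ∀ᶠ z : ℝ × ℝ in smallParams,
      LocallyIntegrable (fun x => z.1 * Vl z.1 x + z.2 ^ 2) volume :=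
    hVl'.mono fun z h =>
      (memLp_top_add_const (h.const_mul z.1) (z.2 ^ 2)).locallyIntegrable le_top
  have hq : ∀ᶠ z : ℝ × ℝ in smallParams, MemLp (fun x => U x + z.1 * Vl z.1 x) ⊤ volume :=
    hVl'.mono fun z h => hU.add (h.const_mul z.1)
  have main := matching_isLittleO (A := Ring.inverse (1 - volterra a b U))
    (J := prim a b (fun _ => 1)) (SU := prim a b U) (SV := prim a b V) (SW := prim a b V₁)
    (P := fun z => prim a b (fun x => z.1 * Vl z.1 x + z.2 ^ 2))
    (F := fun z => jost a b (fun x => U x + z.1 * Vl z.1 x) z.2)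
    (e := prim a b (fun _ => 1) 1) (u := Y) (v := Z)
    (BoundedContinuousFunction.evalCLM ℝ b) hYb (fun x => inverse_apply_apply hun x) hE ?_ ?_
    (by rw [← hY']; exact hY) hZ hzero
  · refine main.congr' ?_ EventuallyEq.rfl
    filter_upwards [hp, hq] with z h1 h2
    have w := jostDeriv_mul_sub (k := z.2) hab hlU h1 h2 (fun x => by ring) (α := 1) (β := 0)
      (u := Y) (u' := Y') (by rw [one_smul]; exact hY) (by rw [zero_smul, zero_add]; exact hY') b
    rw [hYb, hYb', mul_zero, sub_zero, mul_one, sub_zero] at w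
    simp only [BoundedContinuousFunction.evalCLM_apply]
    rw [mismatch, ← w]
    ring
  · filter_upwards [hVl'] with z h
    have hl := h.locallyIntegrable le_top
    have hD : LocallyIntegrable (fun x => Vl z.1 x - V x - z.1 * V₁ x) volume :=
      ((h.sub hV).sub (hV₁.const_mul z.1)).locallyIntegrable le_top
    have e1 : prim a b (Vl z.1) = prim a b V + z.1 • prim a b V₁ +
        prim a b (fun x => Vl z.1 x - V x - z.1 * V₁ x) := by
      have hW : LocallyIntegrable (fun x => z.1 * V₁ x) volume := hlV₁.smul z.1
      have hVW : LocallyIntegrable (fun x => V x + z.1 * V₁ x) volume := hlV.add hW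
      rw [← prim_const_mul hlV₁, ← prim_add hlV hW, ← prim_add hVW hD]
      congr 1
      ext x
      ring
    have hlz : LocallyIntegrable (fun x => z.1 * Vl z.1 x) volume := hl.smul z.1
    rw [prim_add hlz continuous_const.locallyIntegrable, prim_const_mul hl, prim_const, e1]
  · filter_upwards [hp, hq] with z h1 h2
    have e := (jost_eq_iff (k := z.2) h2 hab).1 rfl
    have e2 : (fun x => U x + z.1 * Vl z.1 x + z.2 ^ 2) =
        fun x => U x + (z.1 * Vl z.1 x + z.2 ^ 2) := by ext x; ring
    rw [e2, volterra, prim_add hlU h1] at e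
    refine e.trans ?_
    simp only [mul_apply_eq_comp, add_apply, map_add]
    abel

end Asymptotic

theorem theorem2 (U V V₁ : ℝ → ℝ) (Vl : ℝ → ℝ → ℝ) (u v : ℝ → ℝ) (θ : ℝ)
    (hU : IsBoundedCompactlySupported U)
    (hV : IsBoundedCompactlySupported V)
    (hV₁ : IsBoundedCompactlySupported V₁)
    (hVl : ∀ᶠ lam : ℝ in 𝓝[>] 0, MemLp (Vl lam) ⊤ volume)
    (hVl_supp : ∃ R : ℝ, ∀ᶠ lam : ℝ in 𝓝[>] 0, ∀ᵐ x : ℝ, R < |x| → Vl lam x = 0)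
    (hVl_lim : (fun lam : ℝ =>
        (eLpNorm (fun x => Vl lam x - V x - lam * V₁ x) 2 volume).toReal)
      =o[𝓝[>] 0] (fun lam : ℝ => lam))
    (hu : IsNormalizedHalfBoundState U u θ)
    (hv : IsVStar U V u v)
    (hzero : ∫ x, V x * u x ^ 2 = 0)
    (hneg : ∫ x, (V x * v x + V₁ x * u x) * u x < 0) :
    HasCouplingConstantThreshold (fun lam x => U x + lam * Vl lam x) ∧
    ∀ e : ℝ → ℝ, IsThresholdEigenvalue (fun lam x => U x + lam * Vl lam x) e →
      (fun lam : ℝ => e lam - (-(lam ^ 4 / (θ ^ 2 + 1) ^ 2 *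
          ((∫ x, V x * v x * u x) + ∫ x, V₁ x * u x ^ 2) ^ 2)))
        =o[𝓝[>] 0] (fun lam : ℝ => lam ^ 4) := by
  obtain ⟨R, hR, hU0, hV0, hV₁0, hVl0⟩ := exists_support_interval hU hV hV₁ hVl_supp
  have hab : -R ≤ R := by linarith
  have hlV := hV.1.locallyIntegrable le_top
  have hlV₁ := hV₁.1.locallyIntegrable le_top
  have cu : Continuous u := hu.1.1.1.continuous
  have cv : Continuous v := hv.1.1.continuous
  obtain ⟨Y, Y', hYu, hY, hY', hYb, hYb'⟩ := exists_halfBound_clamped hab hU.1 hU0 hu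
  obtain ⟨Z, hZv, hZ⟩ := exists_vStar_clamped hab hU.1 hV.1 hU0 hV0 hv hYu
  have hVuu : prim (-R) R V (Y * Y) R = 0 := by
    rw [← hzero, prim_apply_eq_integral (f := fun x => u x ^ 2) hab hlV hV0 fun x hx => by
      rw [BoundedContinuousFunction.coe_mul, Pi.mul_apply, hYu x hx, sq]]
  have hVvu : prim (-R) R V (Z * Y) R = ∫ x, V x * v x * u x := by
    simp only [mul_assoc]
    exact prim_apply_eq_integral (f := fun x => v x * u x) hab hlV hV0 fun x hx => by
      rw [BoundedContinuousFunction.coe_mul, Pi.mul_apply, hYu x hx, hZv x hx]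
  have hV₁uu : prim (-R) R V₁ (Y * Y) R = ∫ x, V₁ x * u x ^ 2 :=
    prim_apply_eq_integral (f := fun x => u x ^ 2) hab hlV₁ hV₁0 fun x hx => by
      rw [BoundedContinuousFunction.coe_mul, Pi.mul_apply, hYu x hx, sq]
  set I : ℝ := (∫ x, V x * v x * u x) + ∫ x, V₁ x * u x ^ 2 with hI_def
  have hI : I < 0 := by
    refine lt_of_eq_of_lt ?_ hneg
    have i1 : Integrable (fun x => V x * v x * u x) volume := by
      simpa only [mul_assoc] using
        integrable_mul_of_support (f := fun x => v x * u x) hlV hV0 (cv.mul cu)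
    have i2 : Integrable (fun x => V₁ x * u x ^ 2) volume :=
      integrable_mul_of_support hlV₁ hV₁0 (cu.pow 2)
    rw [hI_def, ← integral_add i1 i2]
    congr 1
    ext x
    ring
  have hθ : θ ≠ 0 := hYb ▸ halfBound_ne_zero hab hU.1 hY hY' hYb'
  have hexp := mismatch_isLittleO hab hU.1 hV.1 hV₁.1 hVl
    (prim_sub_isLittleO hV.1 hV₁.1 hV0 hV₁0 hVl hVl0 hVl_lim) hY hY' hYb hYb' hZ hVuu
  rw [hVvu, hV₁uu, ← hI_def] at hexp
  have hc : 0 < 1 + θ ^ 2 := by positivity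
  let m : ℝ → ℝ → ℝ := fun lam k => θ * mismatch (-R) R (fun x => U x + lam * Vl lam x) k
  have hq : ∀ᶠ lam in 𝓝[>] (0 : ℝ), MemLp (fun x => U x + lam * Vl lam x) ⊤ volume :=
    hVl.mono fun lam h => hU.1.add (h.const_mul lam)
  have hq0 : ∀ᶠ lam in 𝓝[>] (0 : ℝ), ∀ᵐ x, x ∉ Set.Icc (-R) R → U x + lam * Vl lam x = 0 :=
    hVl0.mono fun lam h => by
      filter_upwards [h, hU0] with x h1 h2 hm
      rw [h1 hm, h2 hm, mul_zero, add_zero]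
  constructor
  · obtain ⟨κ, hκ, hκ0⟩ := exists_root (m := m) hc hI
      (hq.mono fun lam h => (continuous_mismatch h hab).const_mul θ) hexp
    have hκpos : ∀ᶠ lam in 𝓝[>] (0 : ℝ), 0 < κ lam := hκ.eventually self_mem_nhdsWithin
    refine ⟨fun lam => -κ lam ^ 2, ?_, ?_⟩
    · filter_upwards [hκ0, hκpos, hq, hq0] with lam h1 h2 h3 h4
      exact ⟨neg_lt_zero.2 (by positivity),
        eigenvalue_of_mismatch_eq_zero h3 hab h2 h4 ((mul_eq_zero.1 h1).resolve_left hθ)⟩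
    · simpa using ((hκ.mono_right nhdsWithin_le_nhds).pow 2).neg
  · rintro e ⟨he, he0⟩
    have hsqrt : Tendsto (fun lam => √(-e lam)) (𝓝[>] 0) (𝓝[>] 0) := by
      refine tendsto_nhdsWithin_iff.2 ⟨?_, he.mono fun lam h => Real.sqrt_pos.2 (by linarith [h.1])⟩
      have : Tendsto (fun lam => √(-e lam)) (𝓝[>] 0) (𝓝 √(-0)) := he0.neg.sqrt
      simpa using this
    have hroot : ∀ᶠ lam in 𝓝[>] 0, m lam (√(-e lam)) = 0 := by
      filter_upwards [he, hq, hq0] with lam h1 h2 h3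
      have hk : 0 < √(-e lam) := Real.sqrt_pos.2 (by linarith [h1.1])
      have hev := h1.2
      rw [show e lam = -√(-e lam) ^ 2 by rw [Real.sq_sqrt (by linarith [h1.1])]; ring] at hev
      exact mul_eq_zero_of_right θ (mismatch_eq_zero_of_eigenvalue h2 hab hk h3 hev)
    have hfin := sq_sub_sq_isLittleO (root_isLittleO hc hexp hsqrt hroot)
    refine hfin.neg_left.congr' (he.mono fun lam h => ?_) EventuallyEq.rfl
    simp only
    rw [Real.sq_sqrt (by linarith [h.1]), div_pow, add_comm 1 (θ ^ 2)]
    ring
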